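/- **Setting.** Let $\mathbf z_1,\mathbf z_2,\dots$ be a stochastic process with values in a standard Borel space $\mathcal Z$, let $\mathcal H\neq\emptyset$ be a hypothesis class (a standard Borel space) and let $\ell:\mathcal H\times\mathcal Z\to[0,1]$ be a jointly measurable loss, not necessarily convex. Let $R_t(h)=\mathbb E[\ell(h,\mathbf z_{t+1})\mid \mathbf z_{1:t}]$ be the conditional risk (computed from the regular conditional distribution) and $d_{i,j}=\sup_{h\in\mathcal H}|R_{i-1}(h)-R_{j-1}(h)|$. Suppose that there are numbers $M_{i,j}$, measurable functions of the observations $\mathbf z_{1:\max(i,j)-1}$, with $d_{i,j}\le M_{i,j}$ almost surely for all $i,j\ge1$. **MACRO.** Fix a threshold $\varepsilon\ge 0$. Start with $N=0$ subroutines. At time $t=1,2,\dots$, let $J=\{1\le j\le N: M_{t,\tau_j}\le\varepsilon\}$; if $J=\emptyset$, start a new subroutine with index $N+1$, set $\tau_{N+1}=t$, $J=\{N+1\}$ and increase $N$ by one. The active subroutine is some $j\in J$ that minimises $M_{t,\tau_j}$. Then observe $\mathbf z_t$ and update every subroutine in $J$ with $\mathbf z_t$. Let $t_{j,1}<\dots<t_{j,s_{j,n}}$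 be the times $\le n$ at which subroutine $j$ is updated, and let $h_{j,i}\in\mathcal H$ be its hypothesis after $i$ updates, which is a measurable function (an arbitrary online learning algorithm) of $\mathbf z_{t_{j,1}},\dots,\mathbf z_{t_{j,i}}$. Let $I_n$ be the index of the subroutine that is active after $\mathbf z_{1:n}$ has been observed (that is, at time $n+1$, before $\mathbf z_{n+1}$ is observed). The regret of subroutine $j$ is $$W_{j,n}=\sum_{i=1}^{s_{j,n}}\ell(h_{j,i-1},\mathbf z_{t_{j,i}})-\inf_{h\in\mathcal H}\sum_{i=1}^{s_{j,n}}\ell(h,\mathbf z_{t_{j,i}}).$$ **Score-based online-to-batch conversion with confidence $\delta$.** For $1\le i\le s_{j,n}$ let $$u_n(j,i)=\frac1{s_{j,n}-i}\sum_{k=i+1}^{s_{j,n}}\ell(h_{j,i},\mathbf z_{t_{j,k}})+c_{j,\delta}(s_{j,n}-i),\qquad c_{j,\delta}(t)=\sqrt{\frac1{2(t+1)}\log\frac{s_{j,n}^3(s_{j,n}+1)}{\delta}},$$ where the average is $0$ if $i=s_{j,n}$. The output of MACRO is $h_n=h_{I_n,J_n}$, where $J_n$ minimises $u_n(I_n,i)$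 over $1\le i\le s_{I_n,n}$ (and $h_n=h_{I_n,0}$ if $s_{I_n,n}=0$). Ties in the two minimisations are broken in any measurable way. **Further notation.** For $n\ge0$ and $k,m\ge1$ let $\operatorname{supp}I_n=\{j:\mathbb P(I_n=j)>0\}$ and $$E_{k,m}=\Big\{|\operatorname{supp}I_n|\le k\ \wedge\ \min_{j\in\operatorname{supp}I_n}s_{j,n}\ge m\Big\}.$$ Let $\mathcal L(\mathcal H)=\{\ell(h,\cdot):h\in\mathcal H\}$. For a class $\mathcal F$ of functions $\mathcal Z\to\mathbb R$, a $\mathcal Z$-valued tree $z$ of depth $n$ is a sequence of maps $z_t:\{\pm1\}^{t-1}\to\mathcal Z$, $1\le t\le n$; a set $V$ of real-valued trees of depth $n$ is a $\beta$-cover of $\mathcal F$ on $z$ if for all $f\in\mathcal F$ and $\sigma\in\{\pm1\}^n$ there is $v\in V$ with $|f(z_t(\sigma_{1:t-1}))-v_t(\sigma_{1:t-1})|\le\beta$ for all $t\le n$; and $\mathcal N_\infty(\mathcal F,\beta,n)\in\mathbb N\cup\{\infty\}$ is the supremum over all $z$ of the smallest size of a $\beta$-cover of $\mathcal F$ on $z$.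 For $\delta\in(0,1]$ and $\beta>0$ let $$U_\delta(j,\beta)=2\sqrt{\frac1{s_{j,n}}\log\frac{s_{j,n}^3(s_{j,n}+1)}{\delta}}+\sqrt{\frac1{s_{j,n}}\log\frac{s_{j,n}^2}{\delta}}+\sqrt{\frac1{s_{j,n}}\log\frac{s_{j,n}^2\,\mathcal N_\infty(\mathcal L(\mathcal H),\beta,n)}{\delta}}+4\beta$$ ($=\infty$ if the covering number is infinite). **Theorem.** For all $n\ge0$, $k,m\ge1$, $\delta\in(0,1]$ and $\beta>0$, $$\mathbb P\Big\{R_n(h_n)-\inf_{h\in\mathcal H}R_n(h)>\frac{W_{I_n,n}}{s_{I_n,n}}+U_\delta(I_n,\beta)+6\varepsilon\Big\}\le\frac{k\delta}{m}+\mathbb P(E_{k,m}^c).$$ -/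

import Mathlib

open MeasureTheory ProbabilityTheory Filter
open scoped ENNReal

/- Conventions. The observations `z_1, z_2, …` of the process are the values `z 0, z 1, …`.
"Round `t`" is the step in which exactly the first `t` observations `z 0, …, z (t - 1)` are known
and `z t` is about to be observed. Subroutines are numbered `0, 1, 2, …`. -/

namespace Macro

noncomputable section

/-! ### Sequential covering numbers -/

/-- An `α`-valued complete binary tree of depth `n`: the label at level `t` depends on the first
`t` signs of the path (`Bool` plays the role of `{-1, 1}`). -/
abbrev BinTree (α : Type*) (n : ℕ) := (t : Fin n) → (Fin t → Bool) → α

/-- The label at level `t` along the path `σ`. -/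
def BinTree.along {α : Type*} {n : ℕ} (z : BinTree α n) (σ : Fin n → Bool) (t : Fin n) : α :=
  z t fun k => σ (Fin.castLE t.isLt.le k)

/-- `V` is a sequential `θ`-cover of the function class `F` on the tree `z` in the `ℓ_∞` sense. -/
def IsSeqCover {Z : Type*} {n : ℕ} (V : Set (BinTree ℝ n)) (F : Set (Z → ℝ)) (θ : ℝ)
    (z : BinTree Z n) : Prop :=
  ∀ f ∈ F, ∀ σ : Fin n → Bool, ∃ v ∈ V, ∀ t : Fin n, |f (z.along σ t) - v.along σ t| ≤ θ

/-- The sequential `θ`-covering number of `F` on the tree `z` (`⊤` if there is no finite cover). -/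
def seqCoveringNumberOn {Z : Type*} {n : ℕ} (F : Set (Z → ℝ)) (θ : ℝ) (z : BinTree Z n) : ℕ∞ :=
  ⨅ (V : Set (BinTree ℝ n)) (_ : IsSeqCover V F θ z), V.encard

/-- The maximal sequential `θ`-covering number of `F` over all trees of depth `n`. -/
def seqCoveringNumber {Z : Type*} (F : Set (Z → ℝ)) (θ : ℝ) (n : ℕ) : ℕ∞ :=
  ⨆ z : BinTree Z n, seqCoveringNumberOn F θ z

/-! ### Conditional risk and discrepancies -/

section Risk

variable {Ω Z H : Type*} [MeasurableSpace Ω] [MeasurableSpace Z]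

/-- The vector of the first `t` observations. -/
def history (z : ℕ → Ω → Z) (t : ℕ) (ω : Ω) : Fin t → Z := fun k => z k ω

variable [StandardBorelSpace Z] [Nonempty Z]

/-- The conditional risk `R_t(h)`: the expected loss of `h` on the next observation under the
regular conditional distribution given the first `t` observations. -/
def condRisk (P : Measure Ω) [IsFiniteMeasure P] (z : ℕ → Ω → Z) (ℓ : H → Z → ℝ)
    (t : ℕ) (h : H) (ω : Ω) : ℝ :=
  ∫ y, ℓ h y ∂(condDistrib (z t) (history z t) P (history z t ω))

/-- The discrepancy between the conditional distributions of rounds `i` and `j`. -/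
def discrepancy (P : Measure Ω) [IsFiniteMeasure P] (z : ℕ → Ω → Z) (ℓ : H → Z → ℝ)
    (i j : ℕ) (ω : Ω) : ℝ :=
  ⨆ h : H, |condRisk P z ℓ i h ω - condRisk P z ℓ j h ω|

end Risk

/-! ### The meta-algorithm, run on a sequence of observations `x` -/

section Algorithm

variable {Z H : Type*}

/-- Observable discrepancy bounds: `M i j` is computed from the observations known in both of the
rounds `i`, `j` or in the later one, that is, from the first `max i j` observations. -/
abbrev DiscBound (Z : Type*) := (i j : ℕ) → (Fin (max i j) → Z) → ℝ

/-- The value of `M i j` on the sequence `x`. -/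
def DiscBound.val (M : DiscBound Z) (x : ℕ → Z) (i j : ℕ) : ℝ := M i j fun k => x k

/-- The existing subroutines that are `ε`-close in round `t`, if `L` lists the rounds in which the
existing subroutines were started. -/
def closeTo (M : DiscBound Z) (ε : ℝ) (x : ℕ → Z) (t : ℕ) (L : List ℕ) : Finset ℕ :=
  (Finset.range L.length).filter fun j => M.val x t (L.getD j 0) ≤ ε

/-- `starts M ε x t` lists the starting rounds of the subroutines that were started before
round `t`; the `j`-th entry belongs to subroutine `j`. A subroutine is started in round `t` if none
of the existing ones is `ε`-close. -/
def starts (M : DiscBound Z) (ε : ℝ) (x : ℕ → Z) : ℕ → List ℕ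
  | 0 => []
  | t + 1 =>
    if closeTo M ε x t (starts M ε x t) = ∅ then starts M ε x t ++ [t] else starts M ε x t

/-- The set `J` of round `t`: all `ε`-close subroutines, or the newly started one if there are
none. Exactly the members of `J` are updated with the observation `x t`. -/
def activeSet (M : DiscBound Z) (ε : ℝ) (x : ℕ → Z) (t : ℕ) : Finset ℕ :=
  if closeTo M ε x t (starts M ε x t) = ∅ then {(starts M ε x t).length}
  else closeTo M ε x t (starts M ε x t)

/-- The starting round `τ_j` of subroutine `j`, for `j` in the active set of round `t`. -/
def startRound (M : DiscBound Z) (ε : ℝ) (x : ℕ → Z) (t j : ℕ) : ℕ :=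
  (starts M ε x (t + 1)).getD j 0

/-- `j` is a closest subroutine in the active set of round `t`. -/
def IsClosest (M : DiscBound Z) (ε : ℝ) (x : ℕ → Z) (t j : ℕ) : Prop :=
  j ∈ activeSet M ε x t ∧ ∀ i ∈ activeSet M ε x t,
    M.val x t (startRound M ε x t j) ≤ M.val x t (startRound M ε x t i)

open scoped Classical in
/-- `s_{j,n}`: how often subroutine `j` has been updated with the first `n` observations. -/
def numUpdates (M : DiscBound Z) (ε : ℝ) (x : ℕ → Z) (j n : ℕ) : ℕ :=
  Nat.count (fun t => j ∈ activeSet M ε x t) n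

/-- `updatePoint M ε x j k` is the observation with which subroutine `j` is updated for the
`(k + 1)`-st time, `z_{t_{j, k + 1}}` (meaningful if there is such an update). -/
def updatePoint (M : DiscBound Z) (ε : ℝ) (x : ℕ → Z) (j k : ℕ) : Z :=
  x (Nat.nth (fun t => j ∈ activeSet M ε x t) k)

/-- Online learning algorithms, one for each subroutine: `A j i v` is the hypothesis of subroutine
`j` after its first `i` updates with the data points `v`. -/
abbrev Learners (Z H : Type*) := ℕ → (i : ℕ) → (Fin i → Z) → H

/-- `h_{j,i}`: the hypothesis of subroutine `j` after `i` updates. -/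
def hyp (A : Learners Z H) (M : DiscBound Z) (ε : ℝ) (x : ℕ → Z) (j i : ℕ) : H :=
  A j i fun k => updatePoint M ε x j k

/-- The regret `W_{j,n}` of subroutine `j`. -/
def regret (A : Learners Z H) (ℓ : H → Z → ℝ) (M : DiscBound Z) (ε : ℝ) (x : ℕ → Z)
    (j n : ℕ) : ℝ :=
  ∑ i ∈ Finset.range (numUpdates M ε x j n), ℓ (hyp A M ε x j i) (updatePoint M ε x j i)
    - ⨅ h : H, ∑ i ∈ Finset.range (numUpdates M ε x j n), ℓ h (updatePoint M ε x j i)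

/-- The average loss of `h_{j,i}` on the data points with which subroutine `j` was updated later
(an empty average is `0`). -/
def testLoss (A : Learners Z H) (ℓ : H → Z → ℝ) (M : DiscBound Z) (ε : ℝ) (x : ℕ → Z)
    (n j i : ℕ) : ℝ :=
  1 / ((numUpdates M ε x j n : ℝ) - i) *
    ∑ k ∈ Finset.Ico i (numUpdates M ε x j n), ℓ (hyp A M ε x j i) (updatePoint M ε x j k)

/-- The confidence width `c_δ(t)` for a subroutine with `s` updates. -/
def width (δ : ℝ) (s : ℕ) (t : ℝ) : ℝ :=
  √(1 / (2 * (t + 1)) * Real.log ((s : ℝ) ^ 3 * (s + 1) / δ))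

/-- The score `u_n(j,i)` of `h_{j,i}`. -/
def score (A : Learners Z H) (ℓ : H → Z → ℝ) (M : DiscBound Z) (ε : ℝ) (x : ℕ → Z)
    (δ : ℝ) (n j i : ℕ) : ℝ :=
  testLoss A ℓ M ε x n j i +
    width δ (numUpdates M ε x j n) ((numUpdates M ε x j n : ℝ) - i)

/-- `i` minimises the score among `1, …, s_{j,n}` (and is `0` if there was no update yet). -/
def IsBestScore (A : Learners Z H) (ℓ : H → Z → ℝ) (M : DiscBound Z) (ε : ℝ) (x : ℕ → Z)
    (δ : ℝ) (n j i : ℕ) : Prop :=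
  (numUpdates M ε x j n = 0 ∧ i = 0) ∨
    (i ∈ Finset.Icc 1 (numUpdates M ε x j n) ∧
      ∀ i' ∈ Finset.Icc 1 (numUpdates M ε x j n),
        score A ℓ M ε x δ n j i ≤ score A ℓ M ε x δ n j i')

/-- The deviation term `U_δ`, for a subroutine with `s` updates and the covering number `N`; it is
infinite if `N` is. -/
def devTerm (δ β : ℝ) (s : ℕ) (N : ℕ∞) : EReal :=
  if N = ⊤ then ⊤ else
    ((2 * √(1 / (s : ℝ) * Real.log ((s : ℝ) ^ 3 * (s + 1) / δ))
      + √(1 / (s : ℝ) * Real.log ((s : ℝ) ^ 2 / δ))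
      + √(1 / (s : ℝ) * Real.log ((s : ℝ) ^ 2 * (N.toNat : ℝ) / δ))
      + 4 * β : ℝ) : EReal)

end Algorithm

/-- The support of a natural-number-valued random variable. -/
def supp {Ω : Type*} [MeasurableSpace Ω] (P : Measure Ω) (I : Ω → ℕ) : Set ℕ :=
  {j | P {ω | I ω = j} ≠ 0}

/-- The event `E_{k,m}`: the index `I` has at most `k` possible values, and each subroutine that
is such a value has been updated at least `m` times with the first `n` observations. -/
def favorable {Ω Z : Type*} [MeasurableSpace Ω] (P : Measure Ω) (z : ℕ → Ω → Z) (M : DiscBound Z)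
    (ε : ℝ) (I : Ω → ℕ) (n k m : ℕ) : Set Ω :=
  {ω | (supp P I).encard ≤ k ∧ ∀ j ∈ supp P I, m ≤ numUpdates M ε (fun t => z t ω) j n}

end

end Macro

/-! Fix a subroutine `j` and a number `s` of updates. In every round in which `j` is active, all
conditional risks are within `ε` of those of its starting round `τ`, so along its updates the risks
are nearly stationary. The competitor is a `β`-near-minimiser of the risk of round `τ`, selected
measurably from the history of that round (`exists_measurable_near_minimizer`). It is fixed when `j`
starts, hence predictable: its losses are compared with its risks by a martingale bound, without any
uniform deviation bound over the class. The covering number therefore enters only through being at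
least `1` (`baseDev_le_devTerm`).

Two kinds of deviations are controlled by a Hoeffding–Azuma inequality along the update times
(`measure_sum_updateDev_le`). For each `i`, the test losses of `h_{j,i}` are compared with its
conditional risks; so its score dominates its risk in round `n` up to `2ε` (`measure_testDev_le`).
Next, the minimal score is at most the average score. Exchanging the sums over hypotheses and data
points turns the sum of the test averages into a sum over updates with weights `1 / (s - i)`.
Together with the learner's own loss and the competitor's loss this is a single martingale, whose
increments have harmonic ranges with squares summing to at most `10 * s` (`measure_regretDev_le`).
The bookkeeping is `mul_excess_le`; there `6ε` is three times `2ε`: from the test rounds to round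
`n`, from the test risks to the risk in the round of use, and from the competitor to the optimum of
round `n`.

For `s ≥ 16` both kinds of failures together have probability at most `δ / (s * (s + 1))`; for
smaller `s` the bound is trivial. Summing over `s ≥ m` telescopes to `δ / m`, and at most `k`
indices contribute. -/

namespace Macro

/-! ### Measurable selection almost everywhere -/

section Selection

/-- The leftmost branch of a scheme of sets through the point `v`. -/
noncomputable def branch {V : Type*} (S : List ℕ → Set V) (v : V) : ℕ → List ℕ
  | 0 => []
  | k + 1 => sInf {m | v ∈ S (m :: branch S v k)} :: branch S v k

/-- The sequence of labels on the leftmost branch. -/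
noncomputable def branchSeq {V : Type*} (S : List ℕ → Set V) (v : V) (k : ℕ) : ℕ :=
  sInf {m | v ∈ S (m :: branch S v k)}

lemma res_branchSeq {V : Type*} (S : List ℕ → Set V) (v : V) (k : ℕ) :
    PiNat.res (branchSeq S v) k = branch S v k := by
  induction k with
  | zero => rfl
  | succ k ih => rw [PiNat.res_succ, ih]; rfl

lemma measurableSet_sInf_eq {V : Type*} [MeasurableSpace V] {S : ℕ → Set V}
    (hS : ∀ m, MeasurableSet (S m)) (m : ℕ) : MeasurableSet {v | sInf {k | v ∈ S k} = m} := by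
  have key : {v | sInf {k | v ∈ S k} = m} =
      {v | (v ∈ S m ∧ ∀ k < m, v ∉ S k) ∨ (m = 0 ∧ ∀ k, v ∉ S k)} := by
    ext v
    simp only [Set.mem_ofPred_eq]
    constructor
    · rintro h
      by_cases hne : {k | v ∈ S k}.Nonempty
      · left
        refine ⟨h ▸ Nat.sInf_mem hne, fun k hk hv => ?_⟩
        exact absurd (Nat.sInf_le (s := {k | v ∈ S k}) hv) (by omega)
      · right
        rw [Set.not_nonempty_iff_eq_empty] at hne
        refine ⟨by rw [← h, hne, Nat.sInf_empty], fun k hk => ?_⟩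
        exact (hne ▸ (show k ∈ {k | v ∈ S k} from hk) : k ∈ (∅ : Set ℕ)).elim
    · rintro (⟨h1, h2⟩ | ⟨rfl, h2⟩)
      · apply le_antisymm (Nat.sInf_le (s := {k | v ∈ S k}) h1)
        refine le_csInf ⟨m, h1⟩ fun k hk => ?_
        by_contra! hlt
        exact h2 k hlt hk
      · have : {k | v ∈ S k} = ∅ := by ext k; simp [h2 k]
        rw [this, Nat.sInf_empty]
  have key' : {v | (v ∈ S m ∧ ∀ k < m, v ∉ S k) ∨ (m = 0 ∧ ∀ k, v ∉ S k)} =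
      (S m ∩ ⋂ k, ⋂ (_ : k < m), (S k)ᶜ) ∪ ({_v : V | m = 0} ∩ ⋂ k, (S k)ᶜ) := by
    ext v
    simp
  rw [key, key']
  exact ((hS m).inter (MeasurableSet.iInter fun k => MeasurableSet.iInter fun _ =>
    (hS k).compl)).union
    ((MeasurableSet.const (m = 0)).inter (MeasurableSet.iInter fun k => (hS k).compl))

lemma measurableSet_branch_eq {V : Type*} [MeasurableSpace V] {S : List ℕ → Set V}
    (hS : ∀ l, MeasurableSet (S l)) (k : ℕ) (l : List ℕ) :
    MeasurableSet {v | branch S v k = l} := by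
  induction k generalizing l with
  | zero => exact MeasurableSet.const ([] = l)
  | succ k ih =>
    cases l with
    | nil => simp [branch]
    | cons m l =>
      have : {v | branch S v (k + 1) = m :: l} =
          {v | sInf {m | v ∈ S (m :: l)} = m} ∩ {v | branch S v k = l} := by
        ext v
        simp only [branch, List.cons.injEq, Set.mem_ofPred_eq, Set.mem_inter_iff]
        constructor
        · rintro ⟨h1, h2⟩; subst h2; exact ⟨h1, rfl⟩
        · rintro ⟨h1, h2⟩; subst h2; exact ⟨h1, rfl⟩
      rw [this]
      exact (measurableSet_sInf_eq (fun m => hS (m :: l)) m).inter (ih l)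

lemma measurable_branchSeq {V : Type*} [MeasurableSpace V] {S : List ℕ → Set V}
    (hS : ∀ l, MeasurableSet (S l)) : Measurable (branchSeq S) := by
  refine measurable_pi_iff.2 fun k => measurable_to_countable' fun m => ?_
  have : (fun v => branchSeq S v k) ⁻¹' {m} =
      ⋃ l : List ℕ, {v | branch S v k = l} ∩ {v | sInf {m | v ∈ S (m :: l)} = m} := by
    ext v
    simp [branchSeq]
  rw [this]
  exact MeasurableSet.iUnion fun l => (measurableSet_branch_eq hS k l).inter
    (measurableSet_sInf_eq (fun m => hS (m :: l)) m)

/-- A continuous map on the Baire space has a measurable section, up to a null set. -/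
theorem exists_measurable_section {V : Type*} [TopologicalSpace V] [T2Space V]
    [MeasurableSpace V] [OpensMeasurableSpace V] (μ : Measure V) [IsFiniteMeasure μ]
    {p : (ℕ → ℕ) → V} (hp : Continuous p) :
    ∃ (B : Set V) (σ : V → ℕ → ℕ), MeasurableSet B ∧ Measurable σ ∧ μ (Set.range p \ B) = 0 ∧
      ∀ v ∈ B, p (σ v) = v := by
  set C : List ℕ → Set V := fun l => p '' {x | PiNat.res x l.length = l} with hC
  -- The images of cylinders need not be measurable. Their hulls are, and have the same outer
  -- measure, so passing to the children loses only a null set. The closures make the scheme shrink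
  -- to points. Lists are read backwards, as in `PiNat.res`: the newest label is the head.
  set S : List ℕ → Set V := fun l => toMeasurable μ (C l) ∩ closure (C l) with hSdef
  have hS : ∀ l, MeasurableSet (S l) := fun l =>
    (measurableSet_toMeasurable _ _).inter isClosed_closure.measurableSet
  have hCS : ∀ l, C l ⊆ S l := fun l =>
    Set.subset_inter (subset_toMeasurable _ _) subset_closure
  have hCU : ∀ l, C l ⊆ ⋃ m, C (m :: l) := by
    rintro l _ ⟨x, hx, rfl⟩
    refine Set.mem_iUnion.2 ⟨x l.length, x, ?_, rfl⟩
    simp only [Set.mem_ofPred_eq] at hx ⊢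
    rw [List.length_cons, PiNat.res_succ, hx]
  have hnull : ∀ l, μ (S l \ ⋃ m, S (m :: l)) = 0 := by
    intro l
    have hU : MeasurableSet (⋃ m, S (m :: l)) := MeasurableSet.iUnion fun m => hS _
    have h1 : μ (S l) ≤ μ (S l ∩ ⋃ m, S (m :: l)) := by
      calc μ (S l) ≤ μ (toMeasurable μ (C l)) := measure_mono Set.inter_subset_left
        _ = μ (C l) := measure_toMeasurable _
        _ ≤ _ := measure_mono (Set.subset_inter (hCS l)
            ((hCU l).trans (Set.iUnion_mono fun m => hCS _)))
    have h2 := measure_inter_add_sdiff (μ := μ) (S l) hU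
    have h3 : μ (S l ∩ ⋃ m, S (m :: l)) + μ (S l \ ⋃ m, S (m :: l)) ≤
        μ (S l ∩ ⋃ m, S (m :: l)) + 0 := by rw [h2, add_zero]; exact h1
    exact le_antisymm ((ENNReal.add_le_add_iff_left (measure_ne_top _ _)).1 h3) bot_le
  set N : Set V := ⋃ l, S l \ ⋃ m, S (m :: l) with hN
  have hNm : MeasurableSet N := MeasurableSet.iUnion fun l =>
    (hS l).diff (MeasurableSet.iUnion fun m => hS _)
  have hN0 : μ N = 0 := measure_iUnion_null hnull
  refine ⟨S [] \ N, branchSeq S, (hS _).diff hNm, measurable_branchSeq hS, ?_, ?_⟩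
  · refine measure_mono_null ?_ hN0
    rintro v ⟨⟨x, rfl⟩, hv⟩
    by_contra hvN
    exact hv ⟨hCS [] ⟨x, by simp, rfl⟩, hvN⟩
  · rintro v ⟨hv0, hvN⟩
    have hmem : ∀ k, v ∈ S (branch S v k) := by
      intro k
      induction k with
      | zero => exact hv0
      | succ k ih =>
        have : v ∈ ⋃ m, S (m :: branch S v k) := by
          by_contra hcon
          exact hvN (Set.mem_iUnion.2 ⟨branch S v k, ih, hcon⟩)
        obtain ⟨m, hm⟩ := Set.mem_iUnion.1 this
        exact Nat.sInf_mem (s := {m | v ∈ S (m :: branch S v k)}) ⟨m, hm⟩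
    -- If `p` missed `v`, a neighbourhood of its value would contain the image of a whole cylinder
    -- of the branch, although `v` lies in the closure of that image.
    by_contra hne
    obtain ⟨U, W, hU, hW, hpU, hvW, hUW⟩ := t2_separation hne
    have hnhds : p ⁻¹' U ∈ nhds (branchSeq S v) := hp.continuousAt.preimage_mem_nhds (hU.mem_nhds hpU)
    obtain ⟨_, ⟨x, k, rfl⟩, hx, hsub⟩ :=
      (PiNat.isTopologicalBasis_cylinders (fun _ => ℕ)).mem_nhds_iff.1 hnhds
    have hk := (hmem k).2
    obtain ⟨_, hyW, y, hy, rfl⟩ := mem_closure_iff.1 hk W hW hvW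
    rw [← res_branchSeq, PiNat.res_length] at hy
    have : y ∈ PiNat.cylinder x k := by
      rw [← PiNat.mem_cylinder_iff_eq.1 hx, PiNat.cylinder_eq_res]
      exact hy
    exact Set.disjoint_left.1 hUW (hsub this) hyW

/-- Measurable selection almost everywhere (Jankov–von Neumann). -/
theorem exists_measurable_selection {V H : Type*} [MeasurableSpace V] [StandardBorelSpace V]
    [MeasurableSpace H] [StandardBorelSpace H] [Nonempty H] (μ : Measure V) [IsFiniteMeasure μ]
    {G : Set (H × V)} (hG : MeasurableSet G) :
    ∃ (B : Set V) (g : V → H), MeasurableSet B ∧ Measurable g ∧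
      μ ({v | ∃ h, (h, v) ∈ G} \ B) = 0 ∧ ∀ v ∈ B, (g v, v) ∈ G := by
  let _ := upgradeStandardBorel V
  let _ := upgradeStandardBorel H
  have hA := hG.analyticSet
  rw [AnalyticSet] at hA
  rcases hA with rfl | ⟨f, hf, rfl⟩
  · exact ⟨∅, fun _ => Classical.arbitrary H, MeasurableSet.empty, measurable_const, by simp,
      by simp⟩
  · obtain ⟨B, σ, hB, hσ, h0, hsec⟩ := exists_measurable_section μ (continuous_snd.comp hf)
    refine ⟨B, fun v => (f (σ v)).1, hB, (measurable_fst.comp hf.measurable).comp hσ, ?_, ?_⟩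
    · refine measure_mono_null (Set.sdiff_subset_sdiff_left ?_) h0
      rintro v ⟨h, x, hx⟩
      exact ⟨x, by simp [hx]⟩
    · intro v hv
      refine ⟨σ v, ?_⟩
      exact Prod.ext rfl (hsec v hv)

/-- A function with values in `[0, 1]` has measurable approximate minimisers in one of its
variables, almost everywhere. -/
theorem exists_measurable_near_minimizer {V H : Type*} [MeasurableSpace V] [StandardBorelSpace V]
    [MeasurableSpace H] [StandardBorelSpace H] [Nonempty H] (μ : Measure V) [IsFiniteMeasure μ]
    {r : H → V → ℝ} (hr : Measurable fun q : H × V => r q.1 q.2)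
    (hr01 : ∀ h v, r h v ∈ Set.Icc (0 : ℝ) 1) {β : ℝ} (hβ : 0 < β) :
    ∃ g : V → H, Measurable g ∧ ∀ᵐ v ∂μ, r (g v) v ≤ (⨅ h, r h v) + β := by
  -- The infimum need not be measurable in `v`, so selections are made below each level of a grid of
  -- mesh `β` and the lowest successful level is used.
  have hG : ∀ q : ℕ, MeasurableSet {p : H × V | r p.1 p.2 < (q + 1) * β} := fun q =>
    measurableSet_lt hr measurable_const
  choose B g hB hg h0 hsel using fun q : ℕ => exists_measurable_selection μ (hG q)
  have hidx : Measurable fun v => sInf {q | v ∈ B q} :=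
    measurable_to_countable' fun m => measurableSet_sInf_eq hB m
  refine ⟨fun v => g (sInf {q | v ∈ B q}) v, ?_, ?_⟩
  · exact (measurable_from_prod_countable_right (f := fun p : ℕ × V => g p.1 p.2) hg).comp
      (hidx.prodMk measurable_id)
  · have hall : ∀ᵐ v ∂μ, ∀ q : ℕ, ¬ v ∈ {v | ∃ h, r h v < (q + 1) * β} \ B q :=
      ae_all_iff.2 fun q => measure_eq_zero_iff_ae_notMem.1 (h0 q)
    filter_upwards [hall] with v hv
    set m := ⨅ h, r h v with hm
    have hbdd : BddBelow (Set.range fun h => r h v) := ⟨0, by rintro _ ⟨h, rfl⟩; exact (hr01 h v).1⟩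
    have hm0 : 0 ≤ m := Real.iInf_nonneg fun h => (hr01 h v).1
    set q := ⌊m / β⌋₊ with hq
    have hq1 : m < (q + 1) * β := by
      have := Nat.lt_floor_add_one (m / β)
      rwa [div_lt_iff₀ hβ] at this
    have hq2 : q * β ≤ m := by
      have := Nat.floor_le (div_nonneg hm0 hβ.le)
      rwa [le_div_iff₀ hβ] at this
    obtain ⟨h, hh⟩ := exists_lt_of_ciInf_lt hq1
    have hvB : v ∈ B q := by
      by_contra hcon
      exact hv q ⟨⟨h, hh⟩, hcon⟩
    have hle : sInf {q | v ∈ B q} ≤ q := Nat.sInf_le hvB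
    have hmem : v ∈ B (sInf {q | v ∈ B q}) := Nat.sInf_mem (s := {q | v ∈ B q}) ⟨q, hvB⟩
    have h1 := hsel _ v hmem
    simp only [Set.mem_ofPred_eq] at h1
    have h2 : ((sInf {q | v ∈ B q} : ℕ) : ℝ) ≤ q := by exact_mod_cast hle
    nlinarith

end Selection

/-! ### An exponential supermartingale -/

section Supermartingale

/-- Hoeffding's lemma in the form of a lower Lebesgue integral. -/
lemma lintegral_exp_centered_le_one {Z : Type*} [MeasurableSpace Z] (ν : Measure Z)
    [IsProbabilityMeasure ν] {f : Z → ℝ} (hf : Measurable f) {lo r : ℝ}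
    (hb : ∀ y, f y ∈ Set.Icc lo (lo + r)) :
    ∫⁻ y, ENNReal.ofReal (Real.exp (f y - ∫ x, f x ∂ν - r ^ 2 / 8)) ∂ν ≤ 1 := by
  have hsub := hasSubgaussianMGF_of_mem_Icc (μ := ν) hf.aemeasurable (Eventually.of_forall hb)
  have hmgf := hsub.mgf_le 1
  have hint := hsub.integrable_exp_mul 1
  simp only [one_mul] at hint
  have hfac : ∀ y, Real.exp (f y - ∫ x, f x ∂ν - r ^ 2 / 8) =
      Real.exp (-(r ^ 2 / 8)) * Real.exp (f y - ∫ x, f x ∂ν) := fun y => by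
    rw [← Real.exp_add]
    congr 1
    ring
  simp_rw [hfac]
  rw [← ofReal_integral_eq_lintegral_ofReal (hint.const_mul _)
    (Eventually.of_forall fun y => by positivity), integral_const_mul, ENNReal.ofReal_le_one]
  simp only [mgf, one_mul] at hmgf
  calc Real.exp (-(r ^ 2 / 8)) * ∫ y, Real.exp (f y - ∫ x, f x ∂ν) ∂ν
      ≤ Real.exp (-(r ^ 2 / 8)) * Real.exp (r ^ 2 / 8) := by
        refine mul_le_mul_of_nonneg_left (hmgf.trans (le_of_eq ?_)) (Real.exp_nonneg _)
        congr 1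
        simp only [add_sub_cancel_left, NNReal.coe_pow, NNReal.coe_div, coe_nnnorm,
          Real.norm_eq_abs, NNReal.coe_ofNat, div_pow, sq_abs]
        ring
    _ = 1 := by rw [← Real.exp_add]; simp

variable {Ω Z : Type*} [MeasurableSpace Ω] [MeasurableSpace Z]

lemma measurable_history {z : ℕ → Ω → Z} (hz : ∀ t, Measurable (z t)) (t : ℕ) :
    Measurable (history z t) :=
  measurable_pi_iff.2 fun k => hz k

variable [StandardBorelSpace Z] [Nonempty Z]

/-- The centered increment of a function of the next observation, corrected by the variance proxy
of Hoeffding's lemma. -/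
noncomputable def centered (P : Measure Ω) [IsFiniteMeasure P] (z : ℕ → Ω → Z)
    (F : (t : ℕ) → (Fin t → Z) → Z → ℝ) (r : (t : ℕ) → (Fin t → Z) → ℝ) (t : ℕ)
    (v : Fin t → Z) (y : Z) : ℝ :=
  F t v y - ∫ x, F t v x ∂(condDistrib (z t) (history z t) P v) - r t v ^ 2 / 8

lemma measurable_centered (P : Measure Ω) [IsFiniteMeasure P] (z : ℕ → Ω → Z)
    {F : (t : ℕ) → (Fin t → Z) → Z → ℝ} {r : (t : ℕ) → (Fin t → Z) → ℝ}
    (hF : ∀ t, Measurable fun q : (Fin t → Z) × Z => F t q.1 q.2) (hr : ∀ t, Measurable (r t))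
    (t : ℕ) : Measurable fun q : (Fin t → Z) × Z => centered P z F r t q.1 q.2 := by
  unfold centered
  refine ((hF t).sub ?_).sub ((((hr t).comp measurable_fst).pow_const 2).div_const 8)
  have := StronglyMeasurable.integral_kernel_prod_right (κ := condDistrib (z t) (history z t) P)
    (f := F t) (hF t).stronglyMeasurable
  exact this.measurable.comp measurable_fst

theorem lintegral_exp_sum_centered_le_one (P : Measure Ω) [IsProbabilityMeasure P]
    {z : ℕ → Ω → Z} (hz : ∀ t, Measurable (z t))
    {F : (t : ℕ) → (Fin t → Z) → Z → ℝ} {lo r : (t : ℕ) → (Fin t → Z) → ℝ}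
    (hF : ∀ t, Measurable fun q : (Fin t → Z) × Z => F t q.1 q.2) (hr : ∀ t, Measurable (r t))
    (hb : ∀ t v y, F t v y ∈ Set.Icc (lo t v) (lo t v + r t v)) (n : ℕ) :
    ∫⁻ ω, ENNReal.ofReal (Real.exp
      (∑ t ∈ Finset.range n, centered P z F r t (history z t ω) (z t ω))) ∂P ≤ 1 := by
  induction n with
  | zero => simp
  | succ n ih =>
    have hmc := measurable_centered P z hF hr
    -- The earlier increments are a function of the history of round `n`, so they factor out of the
    -- inner integral after disintegration.
    set g : (Fin n → Z) → ℝ := fun v =>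
      ∑ t : Fin n, centered P z F r t (fun k => v (Fin.castLE t.isLt.le k)) (v t) with hg
    have hgm : Measurable g := by
      refine Finset.measurable_sum _ fun t _ => ?_
      have hm : Measurable fun v : Fin n → Z =>
          ((fun k : Fin t => v (Fin.castLE t.isLt.le k)), v t) :=
        (measurable_pi_iff.2 fun k => measurable_pi_apply (Fin.castLE t.isLt.le k)).prodMk
          (measurable_pi_apply t)
      exact (hmc t).comp hm
    have hgh : ∀ ω, g (history z n ω) =
        ∑ t ∈ Finset.range n, centered P z F r t (history z t ω) (z t ω) := fun ω => by
      rw [Finset.sum_range]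
      rfl
    set e : (Fin n → Z) × Z → ℝ≥0∞ := fun q =>
      ENNReal.ofReal (Real.exp (g q.1)) * ENNReal.ofReal (Real.exp (centered P z F r n q.1 q.2))
      with he
    have hem : Measurable e :=
      (Real.measurable_exp.comp (hgm.comp measurable_fst)).ennreal_ofReal.mul
        (Real.measurable_exp.comp (hmc n)).ennreal_ofReal
    have hh := measurable_history hz n
    calc ∫⁻ ω, ENNReal.ofReal (Real.exp
          (∑ t ∈ Finset.range (n + 1), centered P z F r t (history z t ω) (z t ω))) ∂P
        = ∫⁻ ω, e (history z n ω, z n ω) ∂P := by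
          refine lintegral_congr fun ω => ?_
          rw [Finset.sum_range_succ, Real.exp_add, ENNReal.ofReal_mul (Real.exp_nonneg _), ← hgh]
      _ = ∫⁻ q, e q ∂(P.map fun ω => (history z n ω, z n ω)) :=
          (lintegral_map hem (hh.prodMk (hz n))).symm
      _ = ∫⁻ q, e q ∂(P.map (history z n) ⊗ₘ condDistrib (z n) (history z n) P) := by
          rw [compProd_map_condDistrib (hz n).aemeasurable]
      _ = ∫⁻ v, ∫⁻ y, e (v, y) ∂(condDistrib (z n) (history z n) P v) ∂(P.map (history z n)) :=
          Measure.lintegral_compProd hem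
      _ ≤ ∫⁻ v, ENNReal.ofReal (Real.exp (g v)) ∂(P.map (history z n)) := by
          -- `condDistrib` is a Markov kernel, so Hoeffding's lemma applies at every `v` and no null
          -- set has to be discarded.
          refine lintegral_mono fun v => ?_
          have hFv : Measurable (F n v) := (hF n).comp measurable_prodMk_left
          have hcv : Measurable (centered P z F r n v) := (hmc n).comp measurable_prodMk_left
          simp only [he]
          have hexp : Measurable fun y => ENNReal.ofReal (Real.exp (centered P z F r n v y)) :=
            (Real.measurable_exp.comp hcv).ennreal_ofReal
          rw [lintegral_const_mul _ hexp]
          calc _ ≤ ENNReal.ofReal (Real.exp (g v)) * 1 :=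
                mul_le_mul_right (lintegral_exp_centered_le_one _ hFv (hb n v)) _
            _ = _ := mul_one _
      _ = ∫⁻ ω, ENNReal.ofReal (Real.exp (g (history z n ω))) ∂P :=
          lintegral_map (Real.measurable_exp.comp hgm).ennreal_ofReal hh
      _ ≤ 1 := by simpa only [hgh] using ih

/-- Markov's inequality for the exponential supermartingale. -/
theorem measure_le_sum_centered_le (P : Measure Ω) [IsProbabilityMeasure P]
    {z : ℕ → Ω → Z} (hz : ∀ t, Measurable (z t))
    {F : (t : ℕ) → (Fin t → Z) → Z → ℝ} {lo r : (t : ℕ) → (Fin t → Z) → ℝ}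
    (hF : ∀ t, Measurable fun q : (Fin t → Z) × Z => F t q.1 q.2) (hr : ∀ t, Measurable (r t))
    (hb : ∀ t v y, F t v y ∈ Set.Icc (lo t v) (lo t v + r t v)) (n : ℕ) (b : ℝ) :
    P {ω | b ≤ ∑ t ∈ Finset.range n, centered P z F r t (history z t ω) (z t ω)} ≤
      ENNReal.ofReal (Real.exp (-b)) := by
  set X : Ω → ℝ := fun ω => ∑ t ∈ Finset.range n, centered P z F r t (history z t ω) (z t ω)
    with hX
  have hXm : Measurable X := Finset.measurable_sum _ fun t _ =>
    (measurable_centered P z hF hr t).comp ((measurable_history hz t).prodMk (hz t))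
  have hexp : 0 < ENNReal.ofReal (Real.exp b) := ENNReal.ofReal_pos.2 (Real.exp_pos _)
  have h1 : P {ω | ENNReal.ofReal (Real.exp b) ≤ ENNReal.ofReal (Real.exp (X ω))} ≤
      1 / ENNReal.ofReal (Real.exp b) :=
    (meas_ge_le_lintegral_div (Real.measurable_exp.comp hXm).ennreal_ofReal.aemeasurable
      hexp.ne' ENNReal.ofReal_ne_top).trans
      (ENNReal.div_le_div_right (lintegral_exp_sum_centered_le_one P hz hF hr hb n) _)
  calc P {ω | b ≤ X ω}
      ≤ P {ω | ENNReal.ofReal (Real.exp b) ≤ ENNReal.ofReal (Real.exp (X ω))} :=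
        measure_mono fun ω hω => ENNReal.ofReal_le_ofReal (Real.exp_le_exp.2 hω)
    _ ≤ _ := h1
    _ = ENNReal.ofReal (Real.exp (-b)) := by
        rw [Real.exp_neg, ENNReal.ofReal_inv_of_pos (Real.exp_pos _), one_div]

end Supermartingale

/-! ### The meta-algorithm as a function of the observations -/

section Counting

lemma exists_count_eq_of_lt_count (p : ℕ → Prop) [DecidablePred p] {k t : ℕ}
    (h : k < Nat.count p t) : ∃ m < t, p m ∧ Nat.count p m = k := by
  induction t with
  | zero => simp at h
  | succ t ih =>
    rw [Nat.count_succ] at h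
    by_cases hk : k < Nat.count p t
    · obtain ⟨m, hm, h1, h2⟩ := ih hk
      exact ⟨m, hm.trans (Nat.lt_succ_self t), h1, h2⟩
    · by_cases hp : p t
      · simp only [hp, if_true] at h
        exact ⟨t, Nat.lt_succ_self t, hp, by omega⟩
      · simp only [hp, if_false] at h
        omega

/-- Changes from the clock of rounds, in which increments are adapted, to the clock of updates, in
which losses are summed. -/
lemma sum_ite_count_eq_sum_nth (p : ℕ → Prop) [DecidablePred p] (f : ℕ → ℕ → ℝ) (n : ℕ) :
    ∑ t ∈ Finset.range n, (if p t then f (Nat.count p t) t else 0) =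
      ∑ k ∈ Finset.range (Nat.count p n), f k (Nat.nth p k) := by
  induction n with
  | zero => simp
  | succ n ih =>
    rw [Finset.sum_range_succ, ih, Nat.count_succ]
    by_cases hp : p n
    · simp [hp, Finset.sum_range_succ, Nat.nth_count hp]
    · simp [hp]

end Counting

/-! ### Causality: the state in a round depends only on earlier observations -/

section Congruence

variable {Z H : Type*} {M : DiscBound Z} {ε : ℝ} {x x' : ℕ → Z}

lemma lt_of_mem_starts {a t : ℕ} (h : a ∈ starts M ε x t) : a < t := by
  induction t with
  | zero => simp [starts] at h
  | succ t ih =>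
    rw [starts] at h
    split_ifs at h
    · rcases List.mem_append.1 h with h | h
      · exact (ih h).trans (Nat.lt_succ_self t)
      · simp only [List.mem_singleton] at h
        omega
    · exact (ih h).trans (Nat.lt_succ_self t)

/-- As `max t τ = t`, the bound reads nothing beyond the first `t` observations. All predictability
below rests on this. -/
lemma val_congr {t τ : ℕ} (h : ∀ u < t, x u = x' u) (hτ : τ ≤ t) :
    M.val x t τ = M.val x' t τ := by
  unfold DiscBound.val
  congr 1
  funext k
  exact h k (k.2.trans_eq (max_eq_left hτ))

lemma closeTo_congr {t : ℕ} (h : ∀ u < t, x u = x' u) {L : List ℕ} (hL : ∀ a ∈ L, a < t) :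
    closeTo M ε x t L = closeTo M ε x' t L := by
  unfold closeTo
  refine Finset.filter_congr fun j hj => ?_
  have hj' : j < L.length := Finset.mem_range.1 hj
  rw [val_congr h (hL _ (by rw [List.getD_eq_getElem _ _ hj']; exact List.getElem_mem hj')).le]

lemma starts_congr {t : ℕ} (h : ∀ u < t, x u = x' u) : starts M ε x t = starts M ε x' t := by
  induction t with
  | zero => rfl
  | succ t ih =>
    have h' : ∀ u < t, x u = x' u := fun u hu => h u (hu.trans (Nat.lt_succ_self t))
    rw [starts, starts, ← ih h', closeTo_congr h' fun a ha => lt_of_mem_starts ha]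

lemma closeTo_starts_congr {t : ℕ} (h : ∀ u < t, x u = x' u) :
    closeTo M ε x t (starts M ε x t) = closeTo M ε x' t (starts M ε x' t) := by
  rw [← starts_congr h, closeTo_congr h fun a ha => lt_of_mem_starts ha]

lemma activeSet_congr {t : ℕ} (h : ∀ u < t, x u = x' u) :
    activeSet M ε x t = activeSet M ε x' t := by
  rw [activeSet, activeSet, closeTo_starts_congr h, starts_congr h]

lemma startRound_congr {t j : ℕ} (h : ∀ u < t, x u = x' u) :
    startRound M ε x t j = startRound M ε x' t j := by
  rw [startRound, startRound, starts, starts, closeTo_starts_congr h, starts_congr h]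

lemma numUpdates_congr {t j : ℕ} (h : ∀ u < t, x u = x' u) :
    numUpdates M ε x j t = numUpdates M ε x' j t := by
  classical
  unfold numUpdates
  rw [Nat.count_eq_card_filter_range, Nat.count_eq_card_filter_range]
  congr 1
  refine Finset.filter_congr fun u hu => ?_
  rw [activeSet_congr fun w hw => h w (hw.trans (Finset.mem_range.1 hu))]

lemma nth_numUpdates {m j : ℕ} (h : j ∈ activeSet M ε x m) :
    Nat.nth (fun t => j ∈ activeSet M ε x t) (numUpdates M ε x j m) = m := by
  classical
  exact Nat.nth_count (p := fun t => j ∈ activeSet M ε x t) h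

lemma updatePoint_congr {t j k : ℕ} (h : ∀ u < t, x u = x' u) (hk : k < numUpdates M ε x j t) :
    updatePoint M ε x j k = updatePoint M ε x' j k := by
  classical
  obtain ⟨m, hm, hp, hc⟩ := exists_count_eq_of_lt_count _ hk
  have hm' : ∀ u < m, x u = x' u := fun u hu => h u (hu.trans hm)
  have hp' : j ∈ activeSet M ε x' m := by rwa [← activeSet_congr hm']
  have hc' : numUpdates M ε x' j m = k := by rw [← numUpdates_congr hm']; exact hc
  have h1 : Nat.nth (fun t => j ∈ activeSet M ε x t) k = m := by
    rw [← hc]; exact nth_numUpdates hp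
  have h2 : Nat.nth (fun t => j ∈ activeSet M ε x' t) k = m := by
    rw [← hc', nth_numUpdates hp']
  rw [updatePoint, updatePoint, h1, h2, h m hm]

lemma hyp_congr {A : Learners Z H} {t j i : ℕ} (h : ∀ u < t, x u = x' u)
    (hi : i ≤ numUpdates M ε x j t) : hyp A M ε x j i = hyp A M ε x' j i := by
  unfold hyp
  congr 1
  funext k
  exact updatePoint_congr h (k.2.trans_le hi)

/-- The default value `0` makes this true also for subroutines that do not exist, so predictability
of the competitor needs no case distinction. -/
lemma startRound_le (x : ℕ → Z) (t j : ℕ) : startRound M ε x t j ≤ t := by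
  unfold startRound
  by_cases hj : j < (starts M ε x (t + 1)).length
  · rw [List.getD_eq_getElem _ _ hj]
    exact Nat.lt_succ_iff.1 (lt_of_mem_starts (List.getElem_mem hj))
  · rw [List.getD_eq_default _ _ (not_lt.1 hj)]
    exact Nat.zero_le t

/-- The list only grows at its end, so a subroutine keeps its index and its starting round forever.
-/
lemma starts_prefix (x : ℕ → Z) {t t' : ℕ} (h : t ≤ t') :
    starts M ε x t <+: starts M ε x t' := by
  induction t', h using Nat.le_induction with
  | base => exact List.prefix_rfl
  | succ t' _ ih =>
    refine ih.trans ?_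
    conv_rhs => rw [starts]
    split_ifs
    · exact List.prefix_append _ _
    · exact List.prefix_rfl

lemma lt_length_starts_of_mem_activeSet {t j : ℕ} (h : j ∈ activeSet M ε x t) :
    j < (starts M ε x (t + 1)).length := by
  rw [activeSet] at h
  rw [starts]
  split_ifs at h ⊢
  · simp only [Finset.mem_singleton] at h
    simp [h]
  · exact Finset.mem_range.1 (Finset.mem_filter.1 h).1

lemma startRound_eq_of_le {t t' j : ℕ} (h : j ∈ activeSet M ε x t) (ht : t ≤ t') :
    startRound M ε x t j = startRound M ε x t' j := by
  have hj := lt_length_starts_of_mem_activeSet h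
  have hpre := starts_prefix (M := M) (ε := ε) x (Nat.succ_le_succ ht)
  unfold startRound
  rw [List.getD_eq_getElem _ _ hj, List.getD_eq_getElem _ _ (hj.trans_le hpre.length_le)]
  exact hpre.getElem hj

/-- The first alternative cannot be absorbed into the second: nothing forces `M t t` to be at most
`ε`. -/
lemma startRound_eq_or_val_le {t j : ℕ} (h : j ∈ activeSet M ε x t) :
    startRound M ε x t j = t ∨ M.val x t (startRound M ε x t j) ≤ ε := by
  unfold startRound
  rw [activeSet] at h
  rw [starts]
  split_ifs at h ⊢
  · left
    simp only [Finset.mem_singleton] at h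
    simp [h]
  · right
    exact (Finset.mem_filter.1 h).2

end Congruence

/-! ### Measurability of the meta-algorithm -/

section Measurability

variable {Z H : Type*} [MeasurableSpace Z] {M : DiscBound Z} (ε : ℝ)

lemma measurable_val (hM : ∀ i j, Measurable (M i j)) (i j : ℕ) :
    Measurable fun x : ℕ → Z => M.val x i j :=
  (hM i j).comp (measurable_pi_iff.2 fun k => measurable_pi_apply (k : ℕ))

lemma measurableSet_closeTo_eq_empty (hM : ∀ i j, Measurable (M i j)) (t : ℕ) (L : List ℕ) :
    MeasurableSet {x : ℕ → Z | closeTo M ε x t L = ∅} := by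
  have : {x : ℕ → Z | closeTo M ε x t L = ∅} =
      ⋂ j, ⋂ (_ : j < L.length), {x | M.val x t (L.getD j 0) ≤ ε}ᶜ := by
    ext x
    simp [closeTo, Finset.filter_eq_empty_iff]
  rw [this]
  exact MeasurableSet.iInter fun j => MeasurableSet.iInter fun _ =>
    (measurableSet_le (measurable_val hM _ _) measurable_const).compl

/-- There are only countably many possible lists; once the previous list is fixed, the recursion
step only tests finitely many inequalities. -/
lemma measurableSet_starts_eq (hM : ∀ i j, Measurable (M i j)) (t : ℕ) (L : List ℕ) :
    MeasurableSet {x : ℕ → Z | starts M ε x t = L} := by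
  induction t generalizing L with
  | zero => exact MeasurableSet.const ([] = L)
  | succ t ih =>
    have : {x : ℕ → Z | starts M ε x (t + 1) = L} = ⋃ K : List ℕ, {x | starts M ε x t = K} ∩
        (({x | closeTo M ε x t K = ∅} ∩ {_x | K ++ [t] = L}) ∪
          ({x | closeTo M ε x t K = ∅}ᶜ ∩ {_x | K = L})) := by
      ext x
      simp only [starts, Set.mem_ofPred_eq, Set.mem_iUnion, Set.mem_inter_iff, Set.mem_union,
        Set.mem_compl_iff, exists_eq_left']
      split_ifs with h <;> simp [h]
    rw [this]
    exact MeasurableSet.iUnion fun K => (ih K).inter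
      (((measurableSet_closeTo_eq_empty ε hM t K).inter (MeasurableSet.const _)).union
        ((measurableSet_closeTo_eq_empty ε hM t K).compl.inter (MeasurableSet.const _)))

lemma measurableSet_mem_activeSet (hM : ∀ i j, Measurable (M i j)) (t j : ℕ) :
    MeasurableSet {x : ℕ → Z | j ∈ activeSet M ε x t} := by
  have : {x : ℕ → Z | j ∈ activeSet M ε x t} = ⋃ K : List ℕ, {x | starts M ε x t = K} ∩
      (({x | closeTo M ε x t K = ∅} ∩ {_x | j = K.length}) ∪
        ({x | closeTo M ε x t K = ∅}ᶜ ∩ ({_x | j < K.length} ∩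
          {x | M.val x t (K.getD j 0) ≤ ε}))) := by
    ext x
    simp only [activeSet, Set.mem_ofPred_eq, Set.mem_iUnion, Set.mem_inter_iff, Set.mem_union,
      Set.mem_compl_iff, exists_eq_left']
    split_ifs with h
    · simp [h]
    · simp only [h, false_and, not_false_eq_true, true_and, false_or]
      simp [closeTo]
  rw [this]
  exact MeasurableSet.iUnion fun K => (measurableSet_starts_eq ε hM t K).inter
    (((measurableSet_closeTo_eq_empty ε hM t K).inter (MeasurableSet.const _)).union
      ((measurableSet_closeTo_eq_empty ε hM t K).compl.inter ((MeasurableSet.const _).inter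
        (measurableSet_le (measurable_val hM _ _) measurable_const))))

lemma measurable_startRound (hM : ∀ i j, Measurable (M i j)) (t j : ℕ) :
    Measurable fun x : ℕ → Z => startRound M ε x t j := by
  refine measurable_to_countable' fun m => ?_
  have : (fun x : ℕ → Z => startRound M ε x t j) ⁻¹' {m} =
      ⋃ K : List ℕ, {x | starts M ε x (t + 1) = K} ∩ {_x | K.getD j 0 = m} := by
    ext x
    simp only [Set.mem_preimage, Set.mem_singleton_iff, Set.mem_iUnion, Set.mem_inter_iff,
      Set.mem_ofPred_eq, exists_eq_left', startRound]
  rw [this]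
  exact MeasurableSet.iUnion fun K =>
    (measurableSet_starts_eq ε hM _ K).inter (MeasurableSet.const _)

lemma measurable_numUpdates (hM : ∀ i j, Measurable (M i j)) (j t : ℕ) :
    Measurable fun x : ℕ → Z => numUpdates M ε x j t := by
  classical
  induction t with
  | zero => simp [numUpdates]
  | succ t ih =>
    have : (fun x : ℕ → Z => numUpdates M ε x j (t + 1)) =
        fun x => numUpdates M ε x j t + if j ∈ activeSet M ε x t then 1 else 0 := by
      funext x
      simp only [numUpdates, Nat.count_succ]
    rw [this]
    exact ih.add (Measurable.ite (measurableSet_mem_activeSet ε hM t j) measurable_const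
      measurable_const)

lemma measurable_nth_update (hM : ∀ i j, Measurable (M i j)) (j k : ℕ) :
    Measurable fun x : ℕ → Z => Nat.nth (fun t => j ∈ activeSet M ε x t) k := by
  classical
  have hpos : ∀ m, MeasurableSet
      {x : ℕ → Z | j ∈ activeSet M ε x m ∧ numUpdates M ε x j m = k} := fun m =>
    (measurableSet_mem_activeSet ε hM m j).inter
      (measurable_numUpdates ε hM j m (measurableSet_singleton k))
  have heq : ∀ m, m ≠ 0 → (fun x : ℕ → Z => Nat.nth (fun t => j ∈ activeSet M ε x t) k) ⁻¹' {m} =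
      {x : ℕ → Z | j ∈ activeSet M ε x m ∧ numUpdates M ε x j m = k} := by
    intro m hm
    ext x
    simp only [Set.mem_preimage, Set.mem_singleton_iff, Set.mem_ofPred_eq]
    constructor
    · rintro rfl
      have hfin : ∀ hf : (Set.ofPred fun t => j ∈ activeSet M ε x t).Finite, k < hf.toFinset.card := by
        intro hf
        by_contra! hcon
        exact hm (Nat.nth_of_card_le hf hcon)
      exact ⟨Nat.nth_mem k hfin, Nat.count_nth hfin⟩
    · rintro ⟨h1, h2⟩
      rw [← h2, nth_numUpdates h1]
  refine measurable_to_countable' fun m => ?_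
  -- `Nat.nth` is `0` when there is no such update, so the fibre over `0` is ambiguous and is
  -- obtained as the complement of the other fibres.
  rcases eq_or_ne m 0 with rfl | hm
  · have : (fun x : ℕ → Z => Nat.nth (fun t => j ∈ activeSet M ε x t) k) ⁻¹' {0} =
        (⋃ m : ℕ, ⋃ (_ : m ≠ 0),
          (fun x : ℕ → Z => Nat.nth (fun t => j ∈ activeSet M ε x t) k) ⁻¹' {m})ᶜ := by
      ext x
      simp only [Set.mem_preimage, Set.mem_singleton_iff, Set.mem_compl_iff, Set.mem_iUnion,
        exists_prop, not_exists, not_and]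
      exact ⟨fun h m hm => h ▸ hm.symm, fun h => by_contra fun h0 => h _ h0 rfl⟩
    rw [this]
    refine (MeasurableSet.iUnion fun m => MeasurableSet.iUnion fun hm => ?_).compl
    rw [heq m hm]
    exact hpos m
  · rw [heq m hm]
    exact hpos m

lemma measurable_updatePoint (hM : ∀ i j, Measurable (M i j)) (j k : ℕ) :
    Measurable fun x : ℕ → Z => updatePoint M ε x j k :=
  (measurable_from_prod_countable_right (f := fun q : ℕ × (ℕ → Z) => q.2 q.1)
    fun t => measurable_pi_apply t).comp ((measurable_nth_update ε hM j k).prodMk measurable_id)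

lemma measurable_hyp [MeasurableSpace H] (hM : ∀ i j, Measurable (M i j)) {A : Learners Z H}
    (hA : ∀ j i, Measurable (A j i)) (j i : ℕ) :
    Measurable fun x : ℕ → Z => hyp A M ε x j i :=
  (hA j i).comp (measurable_pi_iff.2 fun k => measurable_updatePoint ε hM j k)

end Measurability

/-! ### Deviations along the updates of a subroutine -/

section Deviation

variable {Ω Z : Type*} [Nonempty Z]

/-- Extension of a finite history to a sequence of observations. -/
noncomputable def pad {t : ℕ} (v : Fin t → Z) (k : ℕ) : Z :=
  if h : k < t then v ⟨k, h⟩ else Classical.arbitrary Z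

lemma pad_apply {t : ℕ} (x : ℕ → Z) {k : ℕ} (hk : k < t) : pad (fun i : Fin t => x i) k = x k := by
  simp [pad, hk]

variable [MeasurableSpace Ω] [MeasurableSpace Z]

lemma measurable_pad (t : ℕ) : Measurable (pad : (Fin t → Z) → ℕ → Z) := by
  refine measurable_pi_iff.2 fun k => ?_
  by_cases h : k < t
  · simp only [pad, h, dif_pos]
    exact measurable_pi_apply _
  · simp only [pad, h, dif_neg, not_false_eq_true]
    exact measurable_const

variable [StandardBorelSpace Z]

/-- The deviation of `Φ k` from its conditional expectation, at the update number `k + 1` of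
subroutine `j`. -/
noncomputable def updateDev (P : Measure Ω) [IsFiniteMeasure P] (z : ℕ → Ω → Z) (M : DiscBound Z)
    (ε : ℝ) (j : ℕ) (Φ : ℕ → ℕ → (ℕ → Z) → Z → ℝ) (k : ℕ) (ω : Ω) : ℝ :=
  let T := Nat.nth (fun t => j ∈ activeSet M ε (fun t => z t ω) t) k
  Φ k T (fun t => z t ω) (z T ω) -
    ∫ y, Φ k T (fun t => z t ω) y ∂(condDistrib (z T) (history z T) P (history z T ω))

/-- A Hoeffding–Azuma inequality along the updates of a subroutine. -/
theorem measure_sum_updateDev_le (P : Measure Ω) [IsProbabilityMeasure P]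
    {z : ℕ → Ω → Z} (hz : ∀ t, Measurable (z t)) {M : DiscBound Z} (hM : ∀ i j, Measurable (M i j))
    (ε : ℝ) (j n s : ℕ) {Φ : ℕ → ℕ → (ℕ → Z) → Z → ℝ}
    (hΦ : ∀ k t, Measurable fun q : (ℕ → Z) × Z => Φ k t q.1 q.2)
    (hcongr : ∀ t x x' y, (∀ u < t, x u = x' u) →
      Φ (numUpdates M ε x j t) t x y = Φ (numUpdates M ε x j t) t x' y)
    {lo r : ℕ → ℝ} (hb : ∀ k < s, ∀ t x y, Φ k t x y ∈ Set.Icc (lo k) (lo k + r k))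
    {b V : ℝ} (hb0 : 0 ≤ b) (hV : 0 < V) (hrV : ∑ k ∈ Finset.range s, r k ^ 2 ≤ V) :
    P {ω | numUpdates M ε (fun t => z t ω) j n = s ∧
        b ≤ ∑ k ∈ Finset.range s, updateDev P z M ε j Φ k ω} ≤
      ENNReal.ofReal (Real.exp (-(2 * b ^ 2 / V))) := by
  classical
  -- The maximiser of `lam * b - lam ^ 2 * V / 8`, with maximal value `2 * b ^ 2 / V`.
  set lam : ℝ := 4 * b / V with hlam
  have hlam0 : 0 ≤ lam := by positivity
  let c : (t : ℕ) → (Fin t → Z) → ℕ := fun t v => numUpdates M ε (pad v) j t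
  -- Cutting off after `s` updates makes the range bounds, assumed only for `k < s`, hold on every
  -- history. On the event considered it changes nothing before round `n`.
  let act : (t : ℕ) → (Fin t → Z) → Prop := fun t v =>
    j ∈ activeSet M ε (pad v) t ∧ c t v < s
  let F : (t : ℕ) → (Fin t → Z) → Z → ℝ := fun t v y =>
    if act t v then lam * Φ (c t v) t (pad v) y else 0
  let R : (t : ℕ) → (Fin t → Z) → ℝ := fun t v => if act t v then lam * r (c t v) else 0
  let lo' : (t : ℕ) → (Fin t → Z) → ℝ := fun t v => if act t v then lam * lo (c t v) else 0
  have hc : ∀ t, Measurable (c t) := fun t =>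
    (measurable_numUpdates ε hM j t).comp (measurable_pad t)
  have hact : ∀ t, MeasurableSet {v | act t v} := fun t =>
    ((measurable_pad t) (measurableSet_mem_activeSet ε hM t j)).inter
      (measurableSet_lt (hc t) measurable_const)
  have hF : ∀ t, Measurable fun q : (Fin t → Z) × Z => F t q.1 q.2 := by
    intro t
    refine Measurable.ite (measurable_fst (hact t)) (Measurable.const_mul ?_ _) measurable_const
    exact (measurable_from_prod_countable_right
      (f := fun q : ℕ × ((ℕ → Z) × Z) => Φ q.1 t q.2.1 q.2.2) fun k => hΦ k t).comp
      (((hc t).comp measurable_fst).prodMk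
        (((measurable_pad t).comp measurable_fst).prodMk measurable_snd))
  have hR : ∀ t, Measurable (R t) := fun t =>
    Measurable.ite (hact t) (((measurable_of_countable r).comp (hc t)).const_mul _)
      measurable_const
  have hFb : ∀ t v y, F t v y ∈ Set.Icc (lo' t v) (lo' t v + R t v) := by
    intro t v y
    simp only [F, lo', R]
    split_ifs with h
    · have := hb _ h.2 t (pad v) y
      rw [← mul_add]
      exact ⟨mul_le_mul_of_nonneg_left this.1 hlam0, mul_le_mul_of_nonneg_left this.2 hlam0⟩
    · simp
  refine (measure_mono ?_).trans ((measure_le_sum_centered_le P hz hF hR hFb n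
    (2 * b ^ 2 / V)))
  rintro ω ⟨hs, hbω⟩
  simp only [Set.mem_ofPred_eq]
  set x : ℕ → Z := fun t => z t ω with hx
  have hagree : ∀ t, ∀ u < t, x u = pad (history z t ω) u := fun t u hu =>
    (pad_apply x hu).symm
  let D : ℕ → ℕ → ℝ := fun k t => if k < s then lam * (Φ k t x (x t) -
    ∫ y, Φ k t x y ∂(condDistrib (z t) (history z t) P (history z t ω))) - (lam * r k) ^ 2 / 8
    else 0
  have hterm : ∀ t, centered P z F R t (history z t ω) (z t ω) =
      if j ∈ activeSet M ε x t then D (Nat.count (fun t => j ∈ activeSet M ε x t) t) t else 0 := by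
    intro t
    have h1 : activeSet M ε (pad (history z t ω)) t = activeSet M ε x t :=
      (activeSet_congr (hagree t)).symm
    have h2 : c t (history z t ω) = numUpdates M ε x j t := (numUpdates_congr (hagree t)).symm
    have h3 : Nat.count (fun t => j ∈ activeSet M ε x t) t = numUpdates M ε x j t := by
      unfold numUpdates
      congr
    have h4 : ∀ y, Φ (numUpdates M ε x j t) t (pad (history z t ω)) y =
        Φ (numUpdates M ε x j t) t x y := fun y => (hcongr t x _ y (hagree t)).symm
    unfold centered
    simp only [F, R, act, h1, h2, h3, h4, D]
    by_cases hj : j ∈ activeSet M ε x t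
    · by_cases hcs : numUpdates M ε x j t < s
      · simp only [hj, hcs, and_self, if_true, integral_const_mul]
        simp only [hx]
        ring
      · simp [hj, hcs]
    · simp [hj]
  have hsum : ∑ t ∈ Finset.range n, centered P z F R t (history z t ω) (z t ω) =
      lam * ∑ k ∈ Finset.range s, updateDev P z M ε j Φ k ω -
        lam ^ 2 / 8 * ∑ k ∈ Finset.range s, r k ^ 2 := by
    have h3 : Nat.count (fun t => j ∈ activeSet M ε x t) n = s := by
      rw [← hs]
      unfold numUpdates
      congr
    rw [Finset.sum_congr rfl fun t _ => hterm t, sum_ite_count_eq_sum_nth _ D n, h3,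
      Finset.mul_sum, Finset.mul_sum, ← Finset.sum_sub_distrib]
    refine Finset.sum_congr rfl fun k hk => ?_
    simp only [D, Finset.mem_range.1 hk, if_true, updateDev]
    simp only [hx]
    ring
  rw [hsum]
  have e1 : lam * b ≤ lam * ∑ k ∈ Finset.range s, updateDev P z M ε j Φ k ω :=
    mul_le_mul_of_nonneg_left hbω hlam0
  have e2 : lam ^ 2 / 8 * ∑ k ∈ Finset.range s, r k ^ 2 ≤ lam ^ 2 / 8 * V :=
    mul_le_mul_of_nonneg_left hrV (by positivity)
  have e3 : lam * b - lam ^ 2 / 8 * V = 2 * b ^ 2 / V := by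
    rw [hlam]
    field_simp
    ring
  linarith

end Deviation

/-! ### Deterministic inequalities -/

section Harmonic

/-- `1 / s + 1 / (s - 1) + ⋯`, with `k` terms. -/
noncomputable def tailSum (s k : ℕ) : ℝ := ∑ i ∈ Finset.range k, 1 / ((s : ℝ) - i)

lemma tailSum_succ_succ (s k : ℕ) : tailSum (s + 1) (k + 1) = tailSum s k + 1 / ((s : ℝ) + 1) := by
  simp only [tailSum, Finset.sum_range_succ']
  push_cast
  simp

/-- After exchanging the sums, each `1 / (s - i)` occurs exactly `s - i` times; the induction peels
off the first term instead. -/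
lemma sum_tailSum (s : ℕ) : ∑ k ∈ Finset.range s, tailSum s (k + 1) = s := by
  induction s with
  | zero => simp
  | succ s ih =>
    simp only [tailSum_succ_succ, Finset.sum_add_distrib, Finset.sum_const, Finset.card_range,
      nsmul_eq_mul]
    rw [Finset.sum_range_succ', ih]
    push_cast
    simp only [tailSum, Finset.range_zero, Finset.sum_empty]
    field_simp
    ring

/-- Raising `s` adds `1 / (s + 1)` to every term. By `sum_tailSum` the sum of squares then grows by
exactly `2 - 1 / (s + 1)`. -/
lemma sum_sq_tailSum_le (s : ℕ) :
    ∑ k ∈ Finset.range s, tailSum s (k + 1) ^ 2 ≤ 2 * s := by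
  induction s with
  | zero => simp
  | succ s ih =>
    have h0 : tailSum s 0 = 0 := by simp [tailSum]
    have h1 : ∑ k ∈ Finset.range (s + 1), tailSum s k = s := by
      rw [Finset.sum_range_succ', sum_tailSum, h0, add_zero]
    have h2 : ∑ k ∈ Finset.range (s + 1), tailSum s k ^ 2 =
        ∑ k ∈ Finset.range s, tailSum s (k + 1) ^ 2 := by
      rw [Finset.sum_range_succ', h0]
      simp
    have h3 : ∀ k, (tailSum s k + 1 / ((s : ℝ) + 1)) ^ 2 =
        tailSum s k ^ 2 + 2 / ((s : ℝ) + 1) * tailSum s k + (1 / ((s : ℝ) + 1)) ^ 2 := fun k => by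
      ring
    simp only [tailSum_succ_succ, h3, Finset.sum_add_distrib, Finset.sum_const, Finset.card_range,
      nsmul_eq_mul, ← Finset.mul_sum, h1, h2]
    have h4 : 2 / ((s : ℝ) + 1) * s + ((s + 1 : ℕ) : ℝ) * (1 / ((s : ℝ) + 1)) ^ 2 ≤ 2 := by
      push_cast
      have : 2 / ((s : ℝ) + 1) * s + ((s : ℝ) + 1) * (1 / ((s : ℝ) + 1)) ^ 2 =
          2 - 1 / ((s : ℝ) + 1) := by
        field_simp
        ring
      rw [this]
      have : 0 ≤ 1 / ((s : ℝ) + 1) := by positivity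
      linarith
    push_cast at h4 ⊢
    linarith

lemma sum_sq_tailSum_add_two_le (s : ℕ) :
    ∑ k ∈ Finset.range s, (tailSum s (k + 1) + 2) ^ 2 ≤ 10 * (s : ℝ) := by
  have h : ∀ k, (tailSum s (k + 1) + 2) ^ 2 =
      tailSum s (k + 1) ^ 2 + 4 * tailSum s (k + 1) + 4 := fun k => by ring
  simp only [h, Finset.sum_add_distrib, ← Finset.mul_sum, sum_tailSum, Finset.sum_const,
    Finset.card_range, nsmul_eq_mul]
  linarith [sum_sq_tailSum_le s]

/-- Each term is at most `2 * √(i + 1) - 2 * √i`, and these telescope. -/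
lemma sum_one_div_sqrt_le (s : ℕ) : ∑ i ∈ Finset.range s, 1 / √((i : ℝ) + 1) ≤ 2 * √s := by
  induction s with
  | zero => simp
  | succ s ih =>
    rw [Finset.sum_range_succ]
    have ha : 0 ≤ √(s : ℝ) := Real.sqrt_nonneg _
    have hb : 0 < √((s : ℝ) + 1) := Real.sqrt_pos.2 (by positivity)
    have ha2 : √(s : ℝ) ^ 2 = s := Real.sq_sqrt (by positivity)
    have hb2 : √((s : ℝ) + 1) ^ 2 = s + 1 := Real.sq_sqrt (by positivity)
    have : 1 / √((s : ℝ) + 1) ≤ 2 * √((s : ℝ) + 1) - 2 * √(s : ℝ) := by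
      rw [div_le_iff₀ hb]
      nlinarith [sq_nonneg (√((s : ℝ) + 1) - √(s : ℝ))]
    push_cast
    linarith

lemma sum_width_le {δ : ℝ} {s : ℕ} (hL : 0 ≤ Real.log ((s : ℝ) ^ 3 * (s + 1) / δ)) :
    ∑ i ∈ Finset.Icc 1 s, width δ s ((s : ℝ) - i) ≤
      √(2 * Real.log ((s : ℝ) ^ 3 * (s + 1) / δ) * s) := by
  set L := Real.log ((s : ℝ) ^ 3 * (s + 1) / δ) with hLdef
  have h1 : ∑ i ∈ Finset.Icc 1 s, width δ s ((s : ℝ) - i) =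
      ∑ i ∈ Finset.range s, √(L / 2) * (1 / √((i : ℝ) + 1)) := by
    rw [← Finset.sum_range_reflect]
    refine Finset.sum_nbij' (fun i => i - 1) (fun i => i + 1) ?_ ?_ ?_ ?_ ?_
    · intro i hi
      rw [Finset.mem_Icc] at hi
      exact Finset.mem_range.2 (by omega)
    · intro i hi
      rw [Finset.mem_range] at hi
      exact Finset.mem_Icc.2 (by omega)
    · intro i hi
      rw [Finset.mem_Icc] at hi
      omega
    · intro i hi
      omega
    · intro i hi
      rw [Finset.mem_Icc] at hi
      have hcast : ((s - 1 - (i - 1) : ℕ) : ℝ) = s - i := by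
        rw [show s - 1 - (i - 1) = s - i by omega, Nat.cast_sub hi.2]
      have hpos : (0 : ℝ) ≤ s - i := by rw [← hcast]; positivity
      rw [hcast, width, ← hLdef, ← Real.sqrt_one, ← Real.sqrt_div (by norm_num),
        ← Real.sqrt_mul (by positivity), Real.sqrt_one]
      congr 1
      field_simp
  rw [h1, ← Finset.mul_sum]
  calc √(L / 2) * ∑ i ∈ Finset.range s, 1 / √((i : ℝ) + 1) ≤ √(L / 2) * (2 * √s) :=
        mul_le_mul_of_nonneg_left (sum_one_div_sqrt_le s) (Real.sqrt_nonneg _)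
    _ = √(2 * L * s) := by
        have h4 : (2 : ℝ) = √4 := by
          rw [show (4 : ℝ) = 2 ^ 2 by norm_num, Real.sqrt_sq (by norm_num)]
        rw [h4, ← Real.sqrt_mul (by norm_num), ← Real.sqrt_mul (by positivity), ← h4]
        congr 1
        ring

end Harmonic

/-! ### Averaging the scores and exchanging sums -/

section Excess

lemma sum_range_sum_Ico_comm (s : ℕ) (g : ℕ → ℕ → ℝ) :
    ∑ i ∈ Finset.range s, ∑ k ∈ Finset.Ico i s, g i k =
      ∑ k ∈ Finset.range s, ∑ i ∈ Finset.range (k + 1), g i k := by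
  refine Finset.sum_comm' fun i k => ?_
  simp only [Finset.mem_range, Finset.mem_Ico]
  omega

/-- The score-based online-to-batch conversion, compared with a competitor. -/
lemma mul_excess_le {s : ℕ} {loss risk : ℕ → ℕ → ℝ} {lstar rstar c : ℕ → ℝ}
    {ε β ρ W C B x : ℝ} (h0 : ∀ i k, 0 ≤ loss i k)
    (hrisk : ∀ i, ∀ k < s, ∀ k' < s, risk i k ≤ risk i k' + 2 * ε)
    (hx : ∀ i ∈ Finset.Icc 1 s,
      x ≤ 1 / ((s : ℝ) - i) * ∑ k ∈ Finset.Ico i s, loss i k + c i + 2 * ε)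
    (hc : ∑ i ∈ Finset.Icc 1 s, c i ≤ C)
    (hstar : ∀ k < s, rstar k ≤ ρ + β + 2 * ε)
    (hW : ∑ i ∈ Finset.range s, loss i i ≤ W + ∑ k ∈ Finset.range s, lstar k)
    (hB : ∑ k ∈ Finset.range s,
      ((∑ i ∈ Finset.range (k + 1), 1 / ((s : ℝ) - i) * loss i k - loss k k + lstar k) -
        (∑ i ∈ Finset.range (k + 1), 1 / ((s : ℝ) - i) * risk i k - risk k k + rstar k)) ≤ B) :
    s * (x - ρ) ≤ W + C + B + s * (6 * ε + β) := by
  -- The bound for the minimal score holds for every `i`, hence also on average.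
  have hsx : s * x ≤ ∑ i ∈ Finset.Icc 1 s,
      (1 / ((s : ℝ) - i) * ∑ k ∈ Finset.Ico i s, loss i k) + C + s * (2 * ε) := by
    have := Finset.sum_le_sum hx
    simp only [Finset.sum_const, Nat.card_Icc, add_tsub_cancel_right, nsmul_eq_mul,
      Finset.sum_add_distrib] at this
    linarith
  -- The term `i = s` vanishes (empty sum), and the term `i = 0` may be added because losses are
  -- nonnegative. The index set then matches that of the regret.
  have htl : ∑ i ∈ Finset.Icc 1 s, (1 / ((s : ℝ) - i) * ∑ k ∈ Finset.Ico i s, loss i k) ≤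
      ∑ i ∈ Finset.range s, (1 / ((s : ℝ) - i) * ∑ k ∈ Finset.Ico i s, loss i k) := by
    have h1 : ∑ i ∈ Finset.range s, (1 / ((s : ℝ) - i) * ∑ k ∈ Finset.Ico i s, loss i k) =
        ∑ i ∈ Finset.range (s + 1), (1 / ((s : ℝ) - i) * ∑ k ∈ Finset.Ico i s, loss i k) := by
      rw [Finset.sum_range_succ]
      simp
    rw [h1]
    refine Finset.sum_le_sum_of_subset_of_nonneg ?_ ?_
    · intro i hi
      rw [Finset.mem_Icc] at hi
      exact Finset.mem_range.2 (by omega)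
    · intro i hi _
      have : (i : ℝ) ≤ s := by exact_mod_cast Nat.lt_succ_iff.1 (Finset.mem_range.1 hi)
      exact mul_nonneg (one_div_nonneg.2 (by linarith)) (Finset.sum_nonneg fun k _ => h0 i k)
  have hswap : ∀ g : ℕ → ℕ → ℝ,
      ∑ i ∈ Finset.range s, (1 / ((s : ℝ) - i) * ∑ k ∈ Finset.Ico i s, g i k) =
      ∑ k ∈ Finset.range s, ∑ i ∈ Finset.range (k + 1), 1 / ((s : ℝ) - i) * g i k := fun g => by
    rw [← sum_range_sum_Ico_comm s fun i k => 1 / ((s : ℝ) - i) * g i k]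
    exact Finset.sum_congr rfl fun i _ => Finset.mul_sum _ _ _
  have hr : ∑ i ∈ Finset.range s, (1 / ((s : ℝ) - i) * ∑ k ∈ Finset.Ico i s, risk i k) ≤
      ∑ i ∈ Finset.range s, risk i i + s * (2 * ε) := by
    have : ∑ i ∈ Finset.range s, (1 / ((s : ℝ) - i) * ∑ k ∈ Finset.Ico i s, risk i k) ≤
        ∑ i ∈ Finset.range s, (risk i i + 2 * ε) := by
      refine Finset.sum_le_sum fun i hi => ?_
      have hi' := Finset.mem_range.1 hi
      have hpos : (0 : ℝ) < s - i := by
        have : (i : ℝ) < s := by exact_mod_cast hi'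
        linarith
      have h2 : ∑ k ∈ Finset.Ico i s, risk i k ≤ ∑ k ∈ Finset.Ico i s, (risk i i + 2 * ε) :=
        Finset.sum_le_sum fun k hk => hrisk i k (Finset.mem_Ico.1 hk).2 i hi'
      rw [Finset.sum_const, Nat.card_Ico, nsmul_eq_mul, Nat.cast_sub hi'.le] at h2
      rw [one_div, inv_mul_le_iff₀ hpos]
      exact h2
    simpa [Finset.sum_add_distrib] using this
  have hst : ∑ k ∈ Finset.range s, rstar k ≤ s * (ρ + β + 2 * ε) := by
    have := Finset.sum_le_sum fun k hk => hstar k (Finset.mem_range.1 hk)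
    rwa [Finset.sum_const, Finset.card_range, nsmul_eq_mul] at this
  simp only [Finset.sum_sub_distrib, Finset.sum_add_distrib] at hB
  rw [hswap] at htl hr
  linarith

end Excess

/-! ### Numerical estimates for the failure probabilities -/

section Numerics

lemma exp_noise_le {δ : ℝ} (hδ0 : 0 < δ) (hδ1 : δ ≤ 1) {s : ℕ} (hs : 16 ≤ s) :
    Real.exp (-(5 / 4 * Real.log ((s : ℝ) ^ 2 / δ))) ≤ δ / (2 * (s * (s + 1))) := by
  have hs' : (16 : ℝ) ≤ s := by exact_mod_cast hs
  have hq : 0 < (s : ℝ) ^ 2 / δ := by positivity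
  -- The threshold `16` comes from here: a quarter of the logarithm is then at least `log 4`, which
  -- pays for passing from `δ / s ^ 2` to `δ / (2 * (s * (s + 1)))`.
  have h256 : (256 : ℝ) ≤ (s : ℝ) ^ 2 / δ := by
    rw [le_div_iff₀ hδ0]
    nlinarith
  have hlog : 4 * Real.log 4 ≤ Real.log ((s : ℝ) ^ 2 / δ) := by
    have : 4 * Real.log 4 = Real.log 256 := by
      rw [show (256 : ℝ) = 4 ^ 4 by norm_num, Real.log_pow]
      norm_num
    rw [this]
    exact Real.log_le_log (by norm_num) h256
  calc Real.exp (-(5 / 4 * Real.log ((s : ℝ) ^ 2 / δ)))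
      ≤ Real.exp (-Real.log ((s : ℝ) ^ 2 / δ) + -Real.log 4) :=
        Real.exp_le_exp.2 (by linarith)
    _ = δ / (4 * s ^ 2) := by
        rw [Real.exp_add, Real.exp_neg, Real.exp_neg, Real.exp_log hq,
          Real.exp_log (by norm_num)]
        field_simp
    _ ≤ δ / (2 * (s * (s + 1))) := by
        refine div_le_div_of_nonneg_left hδ0.le (by positivity) ?_
        nlinarith

/-- With this the width of an empty test sample is at least `1`, so the untested last hypothesis is
covered trivially. -/
lemma two_le_log {δ : ℝ} (hδ0 : 0 < δ) (hδ1 : δ ≤ 1) {s : ℕ} (hs : 16 ≤ s) :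
    2 ≤ Real.log ((s : ℝ) ^ 3 * (s + 1) / δ) := by
  have hs' : (16 : ℝ) ≤ s := by exact_mod_cast hs
  have h8 : (8 : ℝ) ≤ (s : ℝ) ^ 3 * (s + 1) / δ := by
    rw [le_div_iff₀ hδ0]
    have : (1 : ℝ) ≤ (s : ℝ) ^ 3 := one_le_pow₀ (by linarith)
    nlinarith
  have : 3 * Real.log 2 = Real.log 8 := by
    rw [show (8 : ℝ) = 2 ^ 3 by norm_num, Real.log_pow]
    norm_num
  have := Real.log_le_log (by norm_num) h8
  linarith [Real.log_two_gt_d9]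

/-- The loss of `exp 2 ≤ 8` is paid for by one factor `s`: the logarithm contains `s ^ 3`, of which
only `s ^ 2` is needed. -/
lemma exp_score_le {δ : ℝ} (hδ0 : 0 < δ) {s : ℕ} (hs : 16 ≤ s) :
    Real.exp (2 - Real.log ((s : ℝ) ^ 3 * (s + 1) / δ)) ≤ δ / (2 * (s * (s + 1))) / s := by
  have hs' : (16 : ℝ) ≤ s := by exact_mod_cast hs
  have hq : 0 < (s : ℝ) ^ 3 * (s + 1) / δ := by positivity
  have he : Real.exp 2 ≤ 8 := by
    have : Real.exp 2 = Real.exp 1 ^ 2 := by rw [← Real.exp_nat_mul]; norm_num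
    rw [this]
    nlinarith [Real.exp_one_lt_d9, Real.exp_pos 1]
  rw [Real.exp_sub, Real.exp_log hq, div_div_eq_mul_div, div_div,
    div_le_div_iff₀ (by positivity) (by positivity)]
  have h1 : Real.exp 2 * δ * (2 * (s * (s + 1)) * s) ≤ 8 * δ * (2 * (s * (s + 1)) * s) := by
    gcongr
  have h2 : 0 ≤ δ * ((s : ℝ) ^ 2 * (s + 1)) * (s - 16) :=
    mul_nonneg (by positivity) (by linarith)
  nlinarith

/-- Telescoping of `1 / s - 1 / (s + 1)`; this turns the union over the unknown number of updates
into the factor `1 / m`. -/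
lemma sum_one_div_mul_succ_le {δ : ℝ} (hδ0 : 0 < δ) {m : ℕ} (hm : 1 ≤ m) (n : ℕ) :
    ∑ s ∈ Finset.Ico m n, δ / ((s : ℝ) * (s + 1)) ≤ δ / m := by
  have hm' : (0 : ℝ) < m := by exact_mod_cast hm
  rcases le_total n m with h | h
  · rw [Finset.Ico_eq_empty_of_le h]
    simp only [Finset.sum_empty]
    positivity
  · have : ∑ s ∈ Finset.Ico m n, δ / ((s : ℝ) * (s + 1)) = δ / m - δ / n := by
      induction n, h using Nat.le_induction with
      | base => simp
      | succ n hn ih =>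
        rw [Finset.sum_Ico_succ_top hn, ih]
        have : (0 : ℝ) < n := by exact_mod_cast hm.trans hn
        push_cast
        field_simp
        ring
    rw [this]
    have : 0 ≤ δ / (n : ℝ) := by positivity
    linarith

end Numerics

/-! ### Conditional risks -/

section Risk

variable {Ω Z H : Type*} [MeasurableSpace Ω] [MeasurableSpace Z] [StandardBorelSpace Z]
  [Nonempty Z] {P : Measure Ω} [IsFiniteMeasure P] {z : ℕ → Ω → Z} {ℓ : H → Z → ℝ}

lemma condRisk_mem_Icc (hℓ : ∀ h, Measurable (ℓ h)) (hℓ01 : ∀ h y, ℓ h y ∈ Set.Icc (0 : ℝ) 1)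
    (t : ℕ) (h : H) (ω : Ω) : condRisk P z ℓ t h ω ∈ Set.Icc (0 : ℝ) 1 := by
  unfold condRisk
  refine ⟨integral_nonneg fun y => (hℓ01 h y).1, ?_⟩
  have := integral_mono (μ := condDistrib (z t) (history z t) P (history z t ω))
    (Integrable.of_mem_Icc 0 1 (hℓ h).aemeasurable (Eventually.of_forall (hℓ01 h)))
    (integrable_const (1 : ℝ)) fun y => (hℓ01 h y).2
  simpa using this

lemma bddBelow_condRisk (hℓ : ∀ h, Measurable (ℓ h)) (hℓ01 : ∀ h y, ℓ h y ∈ Set.Icc (0 : ℝ) 1)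
    (t : ℕ) (ω : Ω) : BddBelow (Set.range fun h => condRisk P z ℓ t h ω) :=
  ⟨0, by rintro _ ⟨h, rfl⟩; exact (condRisk_mem_Icc hℓ hℓ01 t h ω).1⟩

lemma abs_condRisk_sub_le_discrepancy (hℓ : ∀ h, Measurable (ℓ h))
    (hℓ01 : ∀ h y, ℓ h y ∈ Set.Icc (0 : ℝ) 1) (i j : ℕ) (h : H) (ω : Ω) :
    |condRisk P z ℓ i h ω - condRisk P z ℓ j h ω| ≤ discrepancy P z ℓ i j ω := by
  unfold discrepancy
  refine le_ciSup (f := fun h => |condRisk P z ℓ i h ω - condRisk P z ℓ j h ω|) ⟨1, ?_⟩ h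
  rintro _ ⟨h, rfl⟩
  have h1 := condRisk_mem_Icc (P := P) (z := z) hℓ hℓ01 i h ω
  have h2 := condRisk_mem_Icc (P := P) (z := z) hℓ hℓ01 j h ω
  exact abs_sub_le_iff.2 ⟨by linarith [h1.2, h2.1], by linarith [h2.2, h1.1]⟩

/-- Near-minimisers of the conditional risk can be chosen measurably in the history. -/
lemma exists_measurable_near_minimizer_condRisk [MeasurableSpace H] [StandardBorelSpace H]
    [Nonempty H] (hz : ∀ t, Measurable (z t)) (hℓ : Measurable fun p : H × Z => ℓ p.1 p.2)
    (hℓ01 : ∀ h y, ℓ h y ∈ Set.Icc (0 : ℝ) 1) {β : ℝ} (hβ : 0 < β) (t : ℕ) :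
    ∃ g : (Fin t → Z) → H, Measurable g ∧ ∀ᵐ ω ∂P,
      condRisk P z ℓ t (g (history z t ω)) ω ≤ (⨅ h, condRisk P z ℓ t h ω) + β := by
  set κ := condDistrib (z t) (history z t) P with hκ
  set r : H → (Fin t → Z) → ℝ := fun h v => ∫ y, ℓ h y ∂(κ v) with hr
  have hℓh : ∀ h, Measurable (ℓ h) := fun h => hℓ.comp measurable_prodMk_left
  have hrm : Measurable fun q : H × (Fin t → Z) => r q.1 q.2 := by
    have := StronglyMeasurable.integral_kernel_prod_right
      (κ := κ.comap (Prod.snd : H × (Fin t → Z) → _) measurable_snd)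
      (f := fun q y => ℓ q.1 y)
      (hℓ.comp ((measurable_fst.comp measurable_fst).prodMk measurable_snd)).stronglyMeasurable
    exact this.measurable
  have hr01 : ∀ h v, r h v ∈ Set.Icc (0 : ℝ) 1 := by
    intro h v
    refine ⟨integral_nonneg fun y => (hℓ01 h y).1, ?_⟩
    have := integral_mono (μ := κ v)
      (Integrable.of_mem_Icc 0 1 (hℓh h).aemeasurable (Eventually.of_forall (hℓ01 h)))
      (integrable_const (1 : ℝ)) fun y => (hℓ01 h y).2
    simpa using this
  obtain ⟨g, hg, hae⟩ := exists_measurable_near_minimizer (P.map (history z t)) hrm hr01 hβ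
  exact ⟨g, hg, ae_of_ae_map (measurable_history hz t).aemeasurable hae⟩

end Risk

/-! ### The two kinds of deviations -/

section Deviations

variable {Ω Z H : Type*} [MeasurableSpace Ω] [MeasurableSpace Z] [StandardBorelSpace Z]
  [Nonempty Z]

/-- The competitor of subroutine `j`: a hypothesis chosen when the subroutine is started. -/
noncomputable def competitor (g : (t : ℕ) → (Fin t → Z) → H) (M : DiscBound Z) (ε : ℝ) (x : ℕ → Z)
    (t j : ℕ) : H :=
  g (startRound M ε x t j) fun u => x u

/-- The negative loss of `h_{j,i}` on the data of later updates. -/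
noncomputable def testDev (A : Learners Z H) (ℓ : H → Z → ℝ) (M : DiscBound Z) (ε : ℝ) (j i : ℕ)
    (k _t : ℕ) (x : ℕ → Z) (y : Z) : ℝ :=
  if i ≤ k then -ℓ (hyp A M ε x j i) y else 0

/-- The contribution of one update to the averaged test losses and the two sums of the regret. -/
noncomputable def regretDev (A : Learners Z H) (ℓ : H → Z → ℝ) (M : DiscBound Z) (ε : ℝ)
    (g : (t : ℕ) → (Fin t → Z) → H) (j s : ℕ) (k t : ℕ) (x : ℕ → Z) (y : Z) : ℝ :=
  ∑ i ∈ Finset.range (k + 1), 1 / ((s : ℝ) - i) * ℓ (hyp A M ε x j i) y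
    - ℓ (hyp A M ε x j k) y + ℓ (competitor g M ε x t j) y

variable [MeasurableSpace H] (P : Measure Ω) [IsProbabilityMeasure P] {z : ℕ → Ω → Z}
  (hz : ∀ t, Measurable (z t)) {ℓ : H → Z → ℝ} (hℓ : Measurable fun p : H × Z => ℓ p.1 p.2)
  (hℓ01 : ∀ h y, ℓ h y ∈ Set.Icc (0 : ℝ) 1) {M : DiscBound Z} (hM : ∀ i j, Measurable (M i j))
  (ε : ℝ) {A : Learners Z H} (hA : ∀ j i, Measurable (A j i))

include hz hℓ hℓ01 hM hA

/-- From update `i` on, the hypothesis is fixed, leaving `s - i` increments of range `1`. Only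
widths below `1` matter, since larger ones bound any risk. The extra factor `1 / s` allows a union
over `i`. -/
theorem measure_testDev_le {δ : ℝ} (hδ0 : 0 < δ) (hδ1 : δ ≤ 1) (j n : ℕ) {s i : ℕ} (hs : 16 ≤ s)
    (hi : i ∈ Finset.Icc 1 s) :
    P {ω | numUpdates M ε (fun t => z t ω) j n = s ∧ (width δ s ((s : ℝ) - i) < 1 ∧
        ((s : ℝ) - i) * width δ s ((s : ℝ) - i) ≤
          ∑ k ∈ Finset.range s, updateDev P z M ε j (testDev A ℓ M ε j i) k ω)} ≤
      ENNReal.ofReal (δ / (2 * (s * (s + 1))) / s) := by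
  set L := Real.log ((s : ℝ) ^ 3 * (s + 1) / δ) with hL
  have hL2 : 2 ≤ L := two_le_log hδ0 hδ1 hs
  set w := width δ s ((s : ℝ) - i) with hw
  by_cases hw1 : w < 1
  swap
  · simp [hw1]
  have his : i ≤ s := (Finset.mem_Icc.1 hi).2
  have his' : (0 : ℝ) ≤ (s : ℝ) - i := by
    have : (i : ℝ) ≤ s := by exact_mod_cast his
    linarith
  have hw0 : 0 ≤ w := Real.sqrt_nonneg _
  have hwsq : w ^ 2 = 1 / (2 * (((s : ℝ) - i) + 1)) * L := by
    rw [hw, width, Real.sq_sqrt (by positivity)]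
  have hwL : w ^ 2 * (2 * (((s : ℝ) - i) + 1)) = L := by
    rw [hwsq]
    field_simp
  have hw2 : w ^ 2 < 1 := by nlinarith
  have hpos : (0 : ℝ) < (s : ℝ) - i := by
    rcases his'.eq_or_lt with h | h
    · rw [← h] at hwL
      linarith
    · exact h
  have hexp : Real.exp (-(2 * (((s : ℝ) - i) * w) ^ 2 / ((s : ℝ) - i))) ≤
      δ / (2 * (s * (s + 1))) / s := by
    refine (Real.exp_le_exp.2 ?_).trans (exp_score_le hδ0 hs)
    -- The width divides by `s - i + 1` instead of `s - i`; the resulting loss `2 * w ^ 2` is below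
    -- `2` because `w < 1`.
    have : 2 * (((s : ℝ) - i) * w) ^ 2 / ((s : ℝ) - i) = L - 2 * w ^ 2 := by
      rw [← hwL]
      field_simp
      ring
    rw [this]
    linarith
  refine (measure_mono ?_).trans ((measure_sum_updateDev_le P hz hM ε j n s
    (Φ := testDev A ℓ M ε j i) (lo := fun k => if i ≤ k then -1 else 0)
    (r := fun k => if i ≤ k then 1 else 0) (b := ((s : ℝ) - i) * w) (V := (s : ℝ) - i)
    ?_ ?_ ?_ (mul_nonneg his' hw0) hpos ?_).trans (ENNReal.ofReal_le_ofReal hexp))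
  · rintro ω ⟨h1, -, h2⟩
    exact ⟨h1, h2⟩
  · intro k t
    unfold testDev
    split_ifs
    · exact (hℓ.comp (((measurable_hyp ε hM hA j i).comp measurable_fst).prodMk
        measurable_snd)).neg
    · exact measurable_const
  · intro t x x' y h
    unfold testDev
    split_ifs with hk
    · rw [hyp_congr h hk]
    · rfl
  · intro k _ t x y
    unfold testDev
    have := hℓ01 (hyp A M ε x j i) y
    split_ifs
    · exact ⟨by linarith [this.2], by linarith [this.1]⟩
    · simp
  · have : ∀ k, (if i ≤ k then (1 : ℝ) else 0) ^ 2 = if i ≤ k then 1 else 0 := fun k => by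
      split_ifs <;> simp
    simp only [this, Finset.sum_boole]
    have h2 : (Finset.range s).filter (fun k => i ≤ k) = Finset.Ico i s := by
      ext k
      simp [and_comm]
    rw [h2, Nat.card_Ico, Nat.cast_sub his]

/-- Treating test losses, learner and competitor as one martingale needs a single deviation bound.
The increment at update `k` lies between `-1` and `tailSum s (k + 1) + 1`, which gives the variance
proxy `10 * s`, and the factor `5 / 2` yields the exponent `5 / 4` of `exp_noise_le`. -/
theorem measure_regretDev_le {δ : ℝ} (hδ0 : 0 < δ) (hδ1 : δ ≤ 1)
    {g : (t : ℕ) → (Fin t → Z) → H} (hg : ∀ t, Measurable (g t)) (j n : ℕ) {s : ℕ} (hs : 16 ≤ s) :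
    P {ω | numUpdates M ε (fun t => z t ω) j n = s ∧
        5 / 2 * s * √(1 / (s : ℝ) * Real.log ((s : ℝ) ^ 2 / δ)) ≤
          ∑ k ∈ Finset.range s, updateDev P z M ε j (regretDev A ℓ M ε g j s) k ω} ≤
      ENNReal.ofReal (δ / (2 * (s * (s + 1)))) := by
  have hs' : (16 : ℝ) ≤ s := by exact_mod_cast hs
  set B := Real.log ((s : ℝ) ^ 2 / δ) with hB
  have hB0 : 0 ≤ B := by
    refine Real.log_nonneg ?_
    rw [le_div_iff₀ hδ0]
    nlinarith
  set b := 5 / 2 * s * √(1 / (s : ℝ) * B) with hb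
  have hexp : Real.exp (-(2 * b ^ 2 / (10 * s))) ≤ δ / (2 * (s * (s + 1))) := by
    refine le_of_eq_of_le ?_ (exp_noise_le hδ0 hδ1 hs)
    rw [hb, mul_pow, Real.sq_sqrt (by positivity)]
    congr 2
    field_simp
    ring
  refine (measure_sum_updateDev_le P hz hM ε j n s
    (Φ := regretDev A ℓ M ε g j s) (lo := fun _ => -1)
    (r := fun k => tailSum s (k + 1) + 2) (b := b) (V := 10 * s)
    ?_ ?_ ?_ (by positivity) (by positivity) (sum_sq_tailSum_add_two_le s)).trans
    (ENNReal.ofReal_le_ofReal hexp)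
  · intro k t
    have hh : ∀ i, Measurable fun q : (ℕ → Z) × Z => ℓ (hyp A M ε q.1 j i) q.2 := fun i =>
      hℓ.comp (((measurable_hyp ε hM hA j i).comp measurable_fst).prodMk measurable_snd)
    have hc : Measurable fun x : ℕ → Z => competitor g M ε x t j :=
      (measurable_from_prod_countable_right
        (f := fun q : ℕ × (ℕ → Z) => g q.1 fun u : Fin q.1 => q.2 u) fun τ =>
          (hg τ).comp (measurable_pi_iff.2 fun u => measurable_pi_apply (u : ℕ))).comp
        ((measurable_startRound ε hM t j).prodMk measurable_id)
    unfold regretDev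
    exact ((Finset.measurable_sum _ fun i _ => (hh i).const_mul _).sub (hh k)).add
      (hℓ.comp ((hc.comp measurable_fst).prodMk measurable_snd))
  · intro t x x' y h
    have hτ : ∀ τ ≤ t, (g τ fun u => x u) = g τ fun u => x' u := fun τ hτ => by
      congr 1
      funext u
      exact h u (u.2.trans_le hτ)
    have hc : competitor g M ε x t j = competitor g M ε x' t j := by
      unfold competitor
      rw [hτ _ (startRound_le x t j), startRound_congr h]
    unfold regretDev
    rw [hc, hyp_congr h le_rfl]
    congr 2
    refine Finset.sum_congr rfl fun i hi => ?_
    rw [hyp_congr h (Nat.lt_succ_iff.1 (Finset.mem_range.1 hi))]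
  · intro k hk t x y
    have hw : ∀ i ∈ Finset.range (k + 1), 0 ≤ 1 / ((s : ℝ) - i) := fun i hi => by
      have : (i : ℝ) ≤ s := by
        exact_mod_cast (Nat.lt_succ_iff.1 (Finset.mem_range.1 hi)).trans hk.le
      exact one_div_nonneg.2 (by linarith)
    have h1 : 0 ≤ ∑ i ∈ Finset.range (k + 1), 1 / ((s : ℝ) - i) * ℓ (hyp A M ε x j i) y :=
      Finset.sum_nonneg fun i hi => mul_nonneg (hw i hi) (hℓ01 _ _).1
    have h2 : ∑ i ∈ Finset.range (k + 1), 1 / ((s : ℝ) - i) * ℓ (hyp A M ε x j i) y ≤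
        tailSum s (k + 1) := by
      refine Finset.sum_le_sum fun i hi => ?_
      exact (mul_le_mul_of_nonneg_left (hℓ01 _ _).2 (hw i hi)).trans_eq (mul_one _)
    have h3 := hℓ01 (hyp A M ε x j k) y
    have h4 := hℓ01 (competitor g M ε x t j) y
    unfold regretDev
    exact ⟨by linarith [h3.2, h4.1], by linarith [h3.1, h4.2]⟩

end Deviations

/-! ### The excess risk outside the exceptional events -/

section Pointwise

/-- A cover of a nonempty class on any tree, for instance a constant one, cannot be empty. -/
lemma one_le_seqCoveringNumber {Z H : Type*} [Nonempty Z] [Nonempty H] {ℓ : H → Z → ℝ} (β : ℝ) (n : ℕ) :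
    1 ≤ seqCoveringNumber (Set.range ℓ) β n := by
  refine le_trans ?_ (le_iSup _ fun _ _ => Classical.arbitrary Z)
  refine le_iInf₂ fun V hV => ?_
  obtain ⟨v, hv, -⟩ := hV _ ⟨Classical.arbitrary H, rfl⟩ fun _ => true
  exact Set.one_le_encard_iff_nonempty.2 ⟨v, hv⟩

lemma nth_update_spec {Z : Type*} {M : DiscBound Z} {ε : ℝ} {x : ℕ → Z} {j k n : ℕ}
    (hk : k < numUpdates M ε x j n) :
    Nat.nth (fun t => j ∈ activeSet M ε x t) k < n ∧
      j ∈ activeSet M ε x (Nat.nth (fun t => j ∈ activeSet M ε x t) k) := by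
  classical
  obtain ⟨m, hm, hp, hc⟩ := exists_count_eq_of_lt_count _ hk
  have : Nat.nth (fun t => j ∈ activeSet M ε x t) k = m := by
    rw [← hc]
    exact nth_numUpdates hp
  rw [this]
  exact ⟨hm, hp⟩

variable {Ω Z H : Type*} [MeasurableSpace Ω] [MeasurableSpace Z] [StandardBorelSpace Z]
  [Nonempty Z] {P : Measure Ω} [IsProbabilityMeasure P] {z : ℕ → Ω → Z} {ℓ : H → Z → ℝ}

/-- The deviation term without covering numbers. -/
noncomputable def baseDev (δ β : ℝ) (s : ℕ) : ℝ :=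
  2 * √(1 / (s : ℝ) * Real.log ((s : ℝ) ^ 3 * (s + 1) / δ))
    + 2 * √(1 / (s : ℝ) * Real.log ((s : ℝ) ^ 2 / δ)) + 4 * β

lemma baseDev_le_devTerm {δ : ℝ} (hδ0 : 0 < δ) (β : ℝ) {s : ℕ} (hs : 1 ≤ s) {N : ℕ∞}
    (hN : 1 ≤ N) : (baseDev δ β s : EReal) ≤ devTerm δ β s N := by
  unfold devTerm
  split_ifs with htop
  · exact le_top
  · have hN1 : (1 : ℝ) ≤ N.toNat := by
      have : 1 ≤ N.toNat := by
        rw [← ENat.natCast_toNat htop] at hN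
        exact_mod_cast hN
      exact_mod_cast this
    have hs' : (0 : ℝ) < s := by exact_mod_cast hs
    rw [EReal.coe_le_coe_iff]
    have hle : √(1 / (s : ℝ) * Real.log ((s : ℝ) ^ 2 / δ)) ≤
        √(1 / (s : ℝ) * Real.log ((s : ℝ) ^ 2 * (N.toNat : ℝ) / δ)) := by
      refine Real.sqrt_le_sqrt (mul_le_mul_of_nonneg_left ?_ (by positivity))
      refine Real.log_le_log (by positivity) (div_le_div_of_nonneg_right ?_ hδ0.le)
      exact le_mul_of_one_le_right (by positivity) hN1
    unfold baseDev
    linarith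

lemma updateDev_testDev {M : DiscBound Z} {ε : ℝ} {A : Learners Z H} (j i k : ℕ) (ω : Ω) :
    updateDev P z M ε j (testDev A ℓ M ε j i) k ω =
      if i ≤ k then
        condRisk P z ℓ (Nat.nth (fun t => j ∈ activeSet M ε (fun t => z t ω) t) k)
          (hyp A M ε (fun t => z t ω) j i) ω -
        ℓ (hyp A M ε (fun t => z t ω) j i) (updatePoint M ε (fun t => z t ω) j k)
      else 0 := by
  simp only [updateDev, testDev, condRisk, updatePoint]
  split_ifs
  · rw [integral_neg]
    ring
  · simp

lemma updateDev_regretDev (hℓ : ∀ h, Measurable (ℓ h))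
    (hℓ01 : ∀ h y, ℓ h y ∈ Set.Icc (0 : ℝ) 1) {M : DiscBound Z} {ε : ℝ} {A : Learners Z H}
    {g : (t : ℕ) → (Fin t → Z) → H} (j s k : ℕ) (ω : Ω) :
    updateDev P z M ε j (regretDev A ℓ M ε g j s) k ω =
      let x := fun t => z t ω
      let T := Nat.nth (fun t => j ∈ activeSet M ε x t) k
      (∑ i ∈ Finset.range (k + 1), 1 / ((s : ℝ) - i) *
            ℓ (hyp A M ε x j i) (updatePoint M ε x j k)
          - ℓ (hyp A M ε x j k) (updatePoint M ε x j k)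
          + ℓ (competitor g M ε x T j) (updatePoint M ε x j k)) -
        (∑ i ∈ Finset.range (k + 1), 1 / ((s : ℝ) - i) * condRisk P z ℓ T (hyp A M ε x j i) ω
          - condRisk P z ℓ T (hyp A M ε x j k) ω
          + condRisk P z ℓ T (competitor g M ε x T j) ω) := by
  simp only [updateDev, regretDev, condRisk, updatePoint]
  congr 1
  have hint : ∀ (ν : Measure Z) [IsFiniteMeasure ν] (h : H), Integrable (ℓ h) ν := fun ν _ h =>
    Integrable.of_mem_Icc 0 1 (hℓ h).aemeasurable (Eventually.of_forall (hℓ01 h))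
  rw [integral_add, integral_sub, integral_finsetSum]
  · simp only [integral_const_mul]
  · exact fun i _ => (hint _ _).const_mul _
  · exact integrable_finsetSum _ fun i _ => (hint _ _).const_mul _
  · exact hint _ _
  · exact (integrable_finsetSum _ fun i _ => (hint _ _).const_mul _).sub (hint _ _)
  · exact hint _ _

/-- For few updates the bound on the excess risk is trivial. -/
lemma excess_le_of_lt {δ : ℝ} (hδ0 : 0 < δ) (hδ1 : δ ≤ 1) {β : ℝ} (hβ : 0 ≤ β) {ε : ℝ}
    (hε : 0 ≤ ε) [Nonempty H] (hℓ : ∀ h, Measurable (ℓ h))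
    (hℓ01 : ∀ h y, ℓ h y ∈ Set.Icc (0 : ℝ) 1) {M : DiscBound Z} {A : Learners Z H} {x : ℕ → Z}
    {j n s : ℕ} (hnum : numUpdates M ε x j n = s) (hs1 : 1 ≤ s) (hs : s < 16) (h : H) (ω : Ω) :
    condRisk P z ℓ n h ω - ⨅ h, condRisk P z ℓ n h ω ≤
      regret A ℓ M ε x j n / s + 6 * ε + baseDev δ β s := by
  have hx : condRisk P z ℓ n h ω - ⨅ h, condRisk P z ℓ n h ω ≤ 1 := by
    have h1 := (condRisk_mem_Icc (P := P) (z := z) hℓ hℓ01 n h ω).2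
    have h2 : 0 ≤ ⨅ h, condRisk P z ℓ n h ω :=
      Real.iInf_nonneg fun h => (condRisk_mem_Icc hℓ hℓ01 n h ω).1
    linarith
  refine hx.trans ?_
  have hs' : (1 : ℝ) ≤ s := by exact_mod_cast hs1
  have hbdd : BddBelow (Set.range fun h : H =>
      ∑ i ∈ Finset.range s, ℓ h (updatePoint M ε x j i)) := by
    refine ⟨0, ?_⟩
    rintro _ ⟨h, rfl⟩
    exact Finset.sum_nonneg fun i _ => (hℓ01 _ _).1
  set L := Real.log ((s : ℝ) ^ 3 * (s + 1) / δ) with hL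
  set B := Real.log ((s : ℝ) ^ 2 / δ) with hB
  have hdiv : ∀ a : ℝ, 0 ≤ a → a ≤ a / δ := fun a ha => by
    rw [le_div_iff₀ hδ0]
    exact mul_le_of_le_one_right ha hδ1
  have hBs : 2 * Real.log s ≤ B := by
    have : 2 * Real.log s = Real.log ((s : ℝ) ^ 2) := by rw [Real.log_pow]; norm_num
    rw [this]
    exact Real.log_le_log (by positivity) (hdiv _ (by positivity))
  have hlogs : 0 ≤ Real.log s := Real.log_nonneg hs'
  have hLs : Real.log 2 + 3 * Real.log s ≤ L := by
    have : Real.log 2 + 3 * Real.log s = Real.log (2 * (s : ℝ) ^ 3) := by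
      rw [Real.log_mul (by norm_num) (by positivity), Real.log_pow]
      norm_num
    rw [this]
    refine Real.log_le_log (by positivity) ((?_ : _ ≤ _).trans (hdiv _ (by positivity)))
    have : (0 : ℝ) < (s : ℝ) ^ 3 := by positivity
    nlinarith
  have hlog2 := Real.log_two_gt_d9
  -- After one update the regret is nonnegative and `2 * √L ≥ 1` suffices. Otherwise the average
  -- regret may be as low as `-1`, so the two roots must add up to at least `1`.
  rcases hs1.eq_or_lt with h1 | h1
  · subst h1
    have hreg : 0 ≤ regret A ℓ M ε x j n := by
      unfold regret
      rw [hnum]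
      have := ciInf_le hbdd (hyp A M ε x j 0)
      simpa using this
    have hsq : 1 / 2 ≤ √(1 / ((1 : ℕ) : ℝ) * L) := by
      refine Real.le_sqrt_of_sq_le ?_
      norm_num at hLs ⊢
      linarith
    unfold baseDev
    have h2 := Real.sqrt_nonneg (1 / ((1 : ℕ) : ℝ) * B)
    have h3 : 0 ≤ regret A ℓ M ε x j n / ((1 : ℕ) : ℝ) := by simpa using hreg
    rw [← hL, ← hB]
    linarith
  · have hreg : -1 ≤ regret A ℓ M ε x j n / s := by
      rw [le_div_iff₀ (by positivity)]
      unfold regret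
      rw [hnum]
      have h1 : 0 ≤ ∑ i ∈ Finset.range s, ℓ (hyp A M ε x j i) (updatePoint M ε x j i) :=
        Finset.sum_nonneg fun i _ => (hℓ01 _ _).1
      have h2 : ⨅ h : H, ∑ i ∈ Finset.range s, ℓ h (updatePoint M ε x j i) ≤ s := by
        refine (ciInf_le hbdd (Classical.arbitrary H)).trans ?_
        have := Finset.sum_le_sum fun i (_ : i ∈ Finset.range s) =>
          (hℓ01 (Classical.arbitrary H) (updatePoint M ε x j i)).2
        simpa using this
      linarith
    -- Checked on the dyadic blocks `2–3`, `4–7`, `8–15` by monotonicity of the logarithm.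
    have hs10 : (s : ℝ) ≤ 8 * Real.log s + Real.log 2 := by
      have hl4 : Real.log 4 = 2 * Real.log 2 := by
        rw [show (4 : ℝ) = 2 ^ 2 by norm_num, Real.log_pow]; norm_num
      have hl8 : Real.log 8 = 3 * Real.log 2 := by
        rw [show (8 : ℝ) = 2 ^ 3 by norm_num, Real.log_pow]; norm_num
      rcases lt_or_ge s 4 with h4 | h4
      · have h5 : (s : ℝ) ≤ 3 := by exact_mod_cast (by omega : s ≤ 3)
        have := Real.log_le_log (by norm_num) (by exact_mod_cast h1 : (2 : ℝ) ≤ s)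
        linarith
      · rcases lt_or_ge s 8 with h8 | h8
        · have h5 : (s : ℝ) ≤ 7 := by exact_mod_cast (by omega : s ≤ 7)
          have := Real.log_le_log (by norm_num) (by exact_mod_cast h4 : (4 : ℝ) ≤ s)
          linarith
        · have h5 : (s : ℝ) ≤ 15 := by exact_mod_cast (by omega : s ≤ 15)
          have := Real.log_le_log (by norm_num) (by exact_mod_cast h8 : (8 : ℝ) ≤ s)
          linarith
    have hB0 : 0 ≤ B := by linarith
    set p := √(1 / (s : ℝ) * L) with hp
    set q := √(1 / (s : ℝ) * B) with hq
    have hp0 : 0 ≤ p := Real.sqrt_nonneg _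
    have hq0 : 0 ≤ q := Real.sqrt_nonneg _
    have hp2 : p ^ 2 * s = L := by
      rw [hp, Real.sq_sqrt (mul_nonneg (by positivity) (by linarith))]
      field_simp
    have hq2 : q ^ 2 * s = B := by
      rw [hq, Real.sq_sqrt (mul_nonneg (by positivity) hB0)]
      field_simp
    have hqp : q ≤ p := by
      refine Real.sqrt_le_sqrt (mul_le_mul_of_nonneg_left ?_ (by positivity))
      refine Real.log_le_log (by positivity) (div_le_div_of_nonneg_right ?_ hδ0.le)
      nlinarith [sq_nonneg (s : ℝ)]
    -- As `q ≤ p`, one has `p ^ 2 + 3 * q ^ 2 ≤ (p + q) ^ 2`, and the left side times `s` is `L + 3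
    -- * B`.
    have hpq : 1 ≤ p + q := by
      have h6 : (s : ℝ) ≤ (p ^ 2 + 3 * q ^ 2) * s := by linarith
      have h7 : 1 ≤ p ^ 2 + 3 * q ^ 2 := by
        by_contra! hcon
        nlinarith
      by_contra! hcon
      nlinarith
    unfold baseDev
    linarith

/-- For many updates the bound on the excess risk holds outside of the exceptional events. -/
lemma excess_le_of_ge {δ : ℝ} (hδ0 : 0 < δ) (hδ1 : δ ≤ 1) {β : ℝ} (hβ : 0 ≤ β) {ε : ℝ}
    (hε : 0 ≤ ε) (hℓ : ∀ h, Measurable (ℓ h)) [Nonempty H]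
    (hℓ01 : ∀ h y, ℓ h y ∈ Set.Icc (0 : ℝ) 1) {M : DiscBound Z} {A : Learners Z H}
    {g : (t : ℕ) → (Fin t → Z) → H} {n s j i : ℕ} {ω : Ω}
    (hdisc : ∀ a b, discrepancy P z ℓ a b ω ≤ M.val (fun t => z t ω) a b)
    (hg : ∀ t, condRisk P z ℓ t (g t (history z t ω)) ω ≤ (⨅ h, condRisk P z ℓ t h ω) + β)
    (hj : j ∈ activeSet M ε (fun t => z t ω) n)
    (hi : IsBestScore A ℓ M ε (fun t => z t ω) δ n j i)
    (hnum : numUpdates M ε (fun t => z t ω) j n = s) (hs : 16 ≤ s)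
    (htest : ∀ i ∈ Finset.Icc 1 s, ¬ (width δ s ((s : ℝ) - i) < 1 ∧
        ((s : ℝ) - i) * width δ s ((s : ℝ) - i) ≤
          ∑ k ∈ Finset.range s, updateDev P z M ε j (testDev A ℓ M ε j i) k ω))
    (hreg : ¬ 5 / 2 * s * √(1 / (s : ℝ) * Real.log ((s : ℝ) ^ 2 / δ)) ≤
          ∑ k ∈ Finset.range s, updateDev P z M ε j (regretDev A ℓ M ε g j s) k ω) :
    condRisk P z ℓ n (hyp A M ε (fun t => z t ω) j i) ω - ⨅ h, condRisk P z ℓ n h ω ≤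
      regret A ℓ M ε (fun t => z t ω) j n / s + 6 * ε + baseDev δ β s := by
  set x : ℕ → Z := fun t => z t ω with hx
  set T : ℕ → ℕ := fun k => Nat.nth (fun t => j ∈ activeSet M ε x t) k with hT
  set L := Real.log ((s : ℝ) ^ 3 * (s + 1) / δ) with hL
  set B := Real.log ((s : ℝ) ^ 2 / δ) with hB
  set τ := startRound M ε x n j with hτ
  have hs' : (16 : ℝ) ≤ s := by exact_mod_cast hs
  have hL2 : 2 ≤ L := two_le_log hδ0 hδ1 hs
  have hB0 : 0 ≤ B := by
    refine Real.log_nonneg ?_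
    rw [le_div_iff₀ hδ0]
    nlinarith
  have hTspec : ∀ k < s, T k < n ∧ j ∈ activeSet M ε x (T k) := fun k hk =>
    nth_update_spec (hnum ▸ hk)
  -- All active rounds are compared with the starting round, so any two of them differ by at most `2
  -- * ε` in every risk.
  have hclose : ∀ t ≤ n, j ∈ activeSet M ε x t → ∀ h,
      |condRisk P z ℓ t h ω - condRisk P z ℓ τ h ω| ≤ ε := by
    intro t ht hjt h
    have hst := startRound_eq_of_le hjt ht
    rcases startRound_eq_or_val_le hjt with h1 | h1
    · rw [hτ, ← hst, h1]
      simpa using hε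
    · rw [hst] at h1
      exact (abs_condRisk_sub_le_discrepancy hℓ hℓ01 t τ h ω).trans ((hdisc t τ).trans h1)
  have hrisk01 := fun t h => condRisk_mem_Icc (P := P) (z := z) hℓ hℓ01 t h ω
  set ρ := ⨅ h, condRisk P z ℓ n h ω with hρ
  set X := condRisk P z ℓ n (hyp A M ε x j i) ω with hX
  -- the bound by the score
  obtain ⟨hi1, hmin⟩ : i ∈ Finset.Icc 1 s ∧ ∀ i' ∈ Finset.Icc 1 s,
      score A ℓ M ε x δ n j i ≤ score A ℓ M ε x δ n j i' := by
    rcases hi with ⟨h, -⟩ | h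
    · omega
    · rwa [hnum] at h
  have hcastle : ∀ i' ∈ Finset.Icc 1 s, (0 : ℝ) ≤ (s : ℝ) - i' := fun i' hi' => by
    have : (i' : ℝ) ≤ s := by exact_mod_cast (Finset.mem_Icc.1 hi').2
    linarith
  have hXu : X ≤ score A ℓ M ε x δ n j i + 2 * ε := by
    have hd := hcastle i hi1
    have hloss0 : 0 ≤ ∑ k ∈ Finset.Ico i s, ℓ (hyp A M ε x j i) (updatePoint M ε x j k) :=
      Finset.sum_nonneg fun k _ => (hℓ01 _ _).1
    simp only [score, testLoss, hnum]
    -- A width of at least `1` bounds the risk by itself; a smaller one forces `i < s`, so the test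
    -- average is over a nonempty sample.
    rcases le_or_gt 1 (width δ s ((s : ℝ) - i)) with hw | hw
    · have : 0 ≤ 1 / ((s : ℝ) - i) *
          ∑ k ∈ Finset.Ico i s, ℓ (hyp A M ε x j i) (updatePoint M ε x j k) :=
        mul_nonneg (one_div_nonneg.2 hd) hloss0
      linarith [(hrisk01 n (hyp A M ε x j i)).2]
    · have hpos : (0 : ℝ) < (s : ℝ) - i := by
        rcases hd.eq_or_lt with h | h
        · exfalso
          rw [← h, width, Real.sqrt_lt' one_pos] at hw
          norm_num at hw
          linarith
        · exact h
      have hlt := htest i hi1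
      simp only [hw, true_and, not_le, updateDev_testDev] at hlt
      rw [← Finset.sum_filter] at hlt
      have hfil : (Finset.range s).filter (fun k => i ≤ k) = Finset.Ico i s := by
        ext k
        simp [and_comm]
      rw [hfil, Finset.sum_sub_distrib] at hlt
      have hr : ((s : ℝ) - i) * (X - 2 * ε) ≤
          ∑ k ∈ Finset.Ico i s, condRisk P z ℓ (T k) (hyp A M ε x j i) ω := by
        have : ∑ _k ∈ Finset.Ico i s, (X - 2 * ε) ≤
            ∑ k ∈ Finset.Ico i s, condRisk P z ℓ (T k) (hyp A M ε x j i) ω := by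
          refine Finset.sum_le_sum fun k hk => ?_
          have hk' := hTspec k (Finset.mem_Ico.1 hk).2
          have h1 := abs_le.1 (hclose n le_rfl hj (hyp A M ε x j i))
          have h2 := abs_le.1 (hclose _ hk'.1.le hk'.2 (hyp A M ε x j i))
          linarith [h1.2, h2.1]
        rwa [Finset.sum_const, Nat.card_Ico, nsmul_eq_mul,
          Nat.cast_sub (Finset.mem_Icc.1 hi1).2] at this
      have hfin : X - 2 * ε - width δ s ((s : ℝ) - i) ≤ 1 / ((s : ℝ) - i) *
          ∑ k ∈ Finset.Ico i s, ℓ (hyp A M ε x j i) (updatePoint M ε x j k) := by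
        rw [one_div, le_inv_mul_iff₀ hpos]
        linarith
      linarith
  -- the competitor
  have hcomp : ∀ k < s, competitor g M ε x (T k) j = g τ (history z τ ω) := by
    intro k hk
    have hk' := hTspec k hk
    unfold competitor
    rw [startRound_eq_of_le hk'.2 hk'.1.le]
    rfl
  set hs := g τ (history z τ ω) with hhs
  have hinf : (⨅ h, condRisk P z ℓ τ h ω) ≤ ρ + ε := by
    rw [← sub_le_iff_le_add]
    refine le_ciInf fun h => ?_
    have h1 := ciInf_le (bddBelow_condRisk (P := P) (z := z) hℓ hℓ01 τ ω) h
    have h2 := abs_le.1 (hclose n le_rfl hj h)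
    linarith [h2.1]
  -- Dividing by `s` leaves `√2` and `5 / 2` as factors of the two roots. Since `√2 ≤ 3 / 2` and the
  -- second root is at most the first, half of the second can be moved over, which gives `2` and
  -- `2`.
  have hkey := mul_excess_le (s := s) (x := X) (ρ := ρ) (ε := ε) (β := β)
    (W := regret A ℓ M ε x j n) (C := √(2 * L * s)) (B := 5 / 2 * s * √(1 / (s : ℝ) * B))
    (loss := fun i k => ℓ (hyp A M ε x j i) (updatePoint M ε x j k))
    (risk := fun i k => condRisk P z ℓ (T k) (hyp A M ε x j i) ω)
    (lstar := fun k => ℓ (competitor g M ε x (T k) j) (updatePoint M ε x j k))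
    (rstar := fun k => condRisk P z ℓ (T k) (competitor g M ε x (T k) j) ω)
    (c := fun i => width δ s ((s : ℝ) - i))
    (fun i k => (hℓ01 _ _).1) ?_ ?_ (sum_width_le (by linarith)) ?_ ?_ ?_
  · have hspos : (0 : ℝ) < s := by linarith
    have hdiv : X - ρ ≤ (regret A ℓ M ε x j n + √(2 * L * s) +
        5 / 2 * s * √(1 / (s : ℝ) * B) + s * (6 * ε + β)) / s := by
      rw [le_div_iff₀ hspos]
      linarith
    have hsq : √(2 * L * s) = √2 * s * √(1 / (s : ℝ) * L) := by
      have : 2 * L * s = 2 * (s : ℝ) ^ 2 * (1 / (s : ℝ) * L) := by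
        field_simp
      rw [this, Real.sqrt_mul (by positivity), Real.sqrt_mul (by norm_num),
        Real.sqrt_sq hspos.le]
    have heq : (regret A ℓ M ε x j n + √(2 * L * s) +
        5 / 2 * s * √(1 / (s : ℝ) * B) + s * (6 * ε + β)) / s =
        regret A ℓ M ε x j n / s + √2 * √(1 / (s : ℝ) * L) + 5 / 2 * √(1 / (s : ℝ) * B) +
          (6 * ε + β) := by
      rw [hsq]
      field_simp
    have hBL : √(1 / (s : ℝ) * B) ≤ √(1 / (s : ℝ) * L) := by
      refine Real.sqrt_le_sqrt (mul_le_mul_of_nonneg_left ?_ (by positivity))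
      refine Real.log_le_log (by positivity) (div_le_div_of_nonneg_right ?_ hδ0.le)
      nlinarith [sq_nonneg (s : ℝ)]
    have h2 : √2 ≤ 3 / 2 := Real.sqrt_le_iff.2 ⟨by norm_num, by norm_num⟩
    have h3 : √2 * √(1 / (s : ℝ) * L) ≤ 3 / 2 * √(1 / (s : ℝ) * L) :=
      mul_le_mul_of_nonneg_right h2 (Real.sqrt_nonneg _)
    unfold baseDev
    linarith
  · intro i' k hk k' hk'
    have h1 := abs_le.1 (hclose _ (hTspec k hk).1.le (hTspec k hk).2 (hyp A M ε x j i'))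
    have h2 := abs_le.1 (hclose _ (hTspec k' hk').1.le (hTspec k' hk').2 (hyp A M ε x j i'))
    linarith [h1.2, h2.1]
  · intro i' hi'
    have := hmin i' hi'
    simp only [score, testLoss, hnum] at this hXu
    linarith
  · intro k hk
    have h1 := abs_le.1 (hclose _ (hTspec k hk).1.le (hTspec k hk).2 hs)
    rw [hcomp k hk]
    linarith [h1.2, hg τ]
  · have hle : ⨅ h : H, ∑ i ∈ Finset.range s, ℓ h (updatePoint M ε x j i) ≤
        ∑ i ∈ Finset.range s, ℓ hs (updatePoint M ε x j i) := by
      refine ciInf_le (f := fun h : H => ∑ i ∈ Finset.range s, ℓ h (updatePoint M ε x j i))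
        ⟨0, ?_⟩ hs
      rintro _ ⟨h, rfl⟩
      exact Finset.sum_nonneg fun i _ => (hℓ01 _ _).1
    have heq : ∑ k ∈ Finset.range s, ℓ (competitor g M ε x (T k) j) (updatePoint M ε x j k) =
        ∑ k ∈ Finset.range s, ℓ hs (updatePoint M ε x j k) :=
      Finset.sum_congr rfl fun k hk => by rw [hcomp k (Finset.mem_range.1 hk)]
    rw [heq, regret, hnum]
    linarith
  · have := (not_le.1 hreg).le
    simp only [updateDev_regretDev hℓ hℓ01] at this
    exact this

end Pointwise

/-! ### Union bounds over hypotheses, update counts and subroutines -/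

section Main

variable {Ω Z H : Type*} [MeasurableSpace Ω] [MeasurableSpace Z] [StandardBorelSpace Z]
  [Nonempty Z] [MeasurableSpace H] [StandardBorelSpace H] [Nonempty H]

lemma measure_compl_supp_eq_zero (P : Measure Ω) (I : Ω → ℕ) : P {ω | I ω ∉ supp P I} = 0 := by
  have : {ω | I ω ∉ supp P I} ⊆ ⋃ j, ⋃ (_ : j ∉ supp P I), {ω | I ω = j} := by
    intro ω hω
    simp only [Set.mem_iUnion]
    exact ⟨I ω, hω, rfl⟩
  refine measure_mono_null this (measure_iUnion_null fun j => measure_iUnion_null fun hj => ?_)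
  simpa [supp] using hj

/-- The excess risk of a subroutine with a fixed number of updates. -/
theorem measure_excess_le (P : Measure Ω) [IsProbabilityMeasure P] {z : ℕ → Ω → Z}
    (hz : ∀ t, Measurable (z t)) {ℓ : H → Z → ℝ} (hℓ : Measurable fun p : H × Z => ℓ p.1 p.2)
    (hℓ01 : ∀ h y, ℓ h y ∈ Set.Icc (0 : ℝ) 1) {M : DiscBound Z} (hM : ∀ i j, Measurable (M i j))
    (hdM : ∀ i j, ∀ᵐ ω ∂P, discrepancy P z ℓ i j ω ≤ M.val (fun t => z t ω) i j)
    {ε : ℝ} (hε : 0 ≤ ε) {A : Learners Z H} (hA : ∀ j i, Measurable (A j i))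
    {δ : ℝ} (hδ0 : 0 < δ) (hδ1 : δ ≤ 1) {β : ℝ} (hβ : 0 < β) (n j : ℕ) {s : ℕ} (hs : 1 ≤ s) :
    P {ω | j ∈ activeSet M ε (fun t => z t ω) n ∧ numUpdates M ε (fun t => z t ω) j n = s ∧
        ∃ i, IsBestScore A ℓ M ε (fun t => z t ω) δ n j i ∧
          regret A ℓ M ε (fun t => z t ω) j n / s + 6 * ε + baseDev δ β s <
            condRisk P z ℓ n (hyp A M ε (fun t => z t ω) j i) ω - ⨅ h, condRisk P z ℓ n h ω} ≤
      ENNReal.ofReal (δ / ((s : ℝ) * (s + 1))) := by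
  have hℓh : ∀ h, Measurable (ℓ h) := fun h => hℓ.comp measurable_prodMk_left
  rcases lt_or_ge s 16 with hs16 | hs16
  · refine (measure_mono_null (t := ∅) ?_ measure_empty).trans_le bot_le
    rintro ω ⟨-, hnum, i, -, hlt⟩
    exact absurd hlt (not_lt.2
      (excess_le_of_lt hδ0 hδ1 hβ.le hε hℓh hℓ01 hnum hs hs16 _ ω))
  choose g hg hgae using fun t =>
    exists_measurable_near_minimizer_condRisk (P := P) hz hℓ hℓ01 hβ t
  have hae : ∀ᵐ ω ∂P, (∀ a b, discrepancy P z ℓ a b ω ≤ M.val (fun t => z t ω) a b) ∧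
      ∀ t, condRisk P z ℓ t (g t (history z t ω)) ω ≤ (⨅ h, condRisk P z ℓ t h ω) + β :=
    (ae_all_iff.2 fun a => ae_all_iff.2 fun b => hdM a b).and (ae_all_iff.2 hgae)
  set E₁ := fun i : ℕ => {ω | numUpdates M ε (fun t => z t ω) j n = s ∧
    (width δ s ((s : ℝ) - i) < 1 ∧ ((s : ℝ) - i) * width δ s ((s : ℝ) - i) ≤
      ∑ k ∈ Finset.range s, updateDev P z M ε j (testDev A ℓ M ε j i) k ω)} with hE₁
  set E₂ := {ω | numUpdates M ε (fun t => z t ω) j n = s ∧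
    5 / 2 * s * √(1 / (s : ℝ) * Real.log ((s : ℝ) ^ 2 / δ)) ≤
      ∑ k ∈ Finset.range s, updateDev P z M ε j (regretDev A ℓ M ε g j s) k ω} with hE₂
  set η := δ / (2 * ((s : ℝ) * (s + 1))) with hη
  have hη0 : 0 ≤ η := by positivity
  have hspos : (0 : ℝ) < s := by exact_mod_cast hs
  have hU : P (⋃ i ∈ Finset.Icc 1 s, E₁ i) ≤ ENNReal.ofReal η := by
    refine (measure_biUnion_finset_le _ _).trans ((Finset.sum_le_sum fun i hi =>
      measure_testDev_le P hz hℓ hℓ01 hM ε hA hδ0 hδ1 j n hs16 hi).trans_eq ?_)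
    rw [Finset.sum_const, Nat.card_Icc, add_tsub_cancel_right, ← ENNReal.ofReal_nsmul,
      nsmul_eq_mul, mul_div_cancel₀ _ hspos.ne']
  have hE₂le : P E₂ ≤ ENNReal.ofReal η :=
    measure_regretDev_le P hz hℓ hℓ01 hM ε hA hδ0 hδ1 hg j n hs16
  calc _ ≤ P ((⋃ i ∈ Finset.Icc 1 s, E₁ i) ∪ E₂) := by
        -- The inclusion holds off one null set, on which some discrepancy bound or some
        -- near-minimality fails; there are countably many of these conditions.
        refine measure_mono_ae ?_
        filter_upwards [hae] with ω hω
        rintro ⟨hj, hnum, i, hi, hlt⟩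
        by_contra hcon
        have hcon' : ω ∉ (⋃ i ∈ Finset.Icc 1 s, E₁ i) ∪ E₂ := hcon
        simp only [Set.mem_union, Set.mem_iUnion, not_or, not_exists] at hcon'
        refine absurd hlt (not_lt.2 (excess_le_of_ge hδ0 hδ1 hβ.le hε hℓh hℓ01 hω.1 hω.2 hj hi
          hnum hs16 (fun i' hi' h => hcon'.1 i' hi' ⟨hnum, h⟩) fun h => hcon'.2 ⟨hnum, h⟩))
    _ ≤ ENNReal.ofReal η + ENNReal.ofReal η := (measure_union_le _ _).trans (add_le_add hU hE₂le)
    _ = ENNReal.ofReal (δ / ((s : ℝ) * (s + 1))) := by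
        rw [← ENNReal.ofReal_add hη0 hη0]
        congr 1
        rw [hη]
        field_simp
        ring

end Main

end Macro

theorem theorem3
    {Ω Z H : Type*} [MeasurableSpace Ω]
    [MeasurableSpace Z] [StandardBorelSpace Z] [Nonempty Z]
    [MeasurableSpace H] [StandardBorelSpace H] [Nonempty H]
    -- the process
    (P : Measure Ω) [IsProbabilityMeasure P] (z : ℕ → Ω → Z) (hz : ∀ t, Measurable (z t))
    -- the loss
    (ℓ : H → Z → ℝ) (hℓ : Measurable fun p : H × Z => ℓ p.1 p.2)
    (hℓ01 : ∀ h y, ℓ h y ∈ Set.Icc (0 : ℝ) 1)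
    -- observable upper bounds on the discrepancies
    (M : Macro.DiscBound Z) (hM : ∀ i j, Measurable (M i j))
    (hdM : ∀ i j, ∀ᵐ ω ∂P, Macro.discrepancy P z ℓ i j ω ≤ M.val (fun t => z t ω) i j)
    -- the threshold and the online subroutines
    (ε : ℝ) (hε : 0 ≤ ε)
    (A : Macro.Learners Z H) (hA : ∀ j i, Measurable (A j i))
    -- the parameters
    (δ : ℝ) (hδ0 : 0 < δ) (hδ1 : δ ≤ 1) (β : ℝ) (hβ : 0 < β)
    (n k m : ℕ) (hk : 1 ≤ k) (hm : 1 ≤ m)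
    -- `I` is the chosen subroutine and `i` the index of its hypothesis with the best score,
    -- both based on the first `n` observations, with ties broken in any way
    (I : Ω → ℕ) (hI : Measurable I)
    (hI_min : ∀ ω, Macro.IsClosest M ε (fun t => z t ω) n (I ω))
    (i : Ω → ℕ) (hi : Measurable i)
    (hi_min : ∀ ω, Macro.IsBestScore A ℓ M ε (fun t => z t ω) δ n (I ω) (i ω)) :
    P {ω |
        ((Macro.regret A ℓ M ε (fun t => z t ω) (I ω) n
              / Macro.numUpdates M ε (fun t => z t ω) (I ω) n + 6 * ε : ℝ) : EReal)
            + Macro.devTerm δ β (Macro.numUpdates M ε (fun t => z t ω) (I ω) n)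
                (Macro.seqCoveringNumber (Set.range ℓ) β n)
          < ((Macro.condRisk P z ℓ n (Macro.hyp A M ε (fun t => z t ω) (I ω) (i ω)) ω
              - ⨅ h : H, Macro.condRisk P z ℓ n h ω : ℝ) : EReal)}
      ≤ ENNReal.ofReal (k * δ / m) + P (Macro.favorable P z M ε I n k m)ᶜ := by
  classical
  set B := {ω |
    ((Macro.regret A ℓ M ε (fun t => z t ω) (I ω) n
          / Macro.numUpdates M ε (fun t => z t ω) (I ω) n + 6 * ε : ℝ) : EReal)
        + Macro.devTerm δ β (Macro.numUpdates M ε (fun t => z t ω) (I ω) n)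
            (Macro.seqCoveringNumber (Set.range ℓ) β n)
      < ((Macro.condRisk P z ℓ n (Macro.hyp A M ε (fun t => z t ω) (I ω) (i ω)) ω
          - ⨅ h : H, Macro.condRisk P z ℓ n h ω : ℝ) : EReal)} with hB
  by_cases hsupp : (Macro.supp P I).encard ≤ k
  swap
  · have hE : Macro.favorable P z M ε I n k m = ∅ := by
      ext ω
      simp [Macro.favorable, hsupp]
    rw [hE, Set.compl_empty, measure_univ]
    exact prob_le_one.trans le_add_self
  have hfin : (Macro.supp P I).Finite := Set.finite_of_encard_le_coe hsupp
  have hcard : hfin.toFinset.card ≤ k := by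
    rw [hfin.encard_eq_coe_toFinset_card] at hsupp
    exact_mod_cast hsupp
  set E : ℕ → ℕ → Set Ω := fun j s =>
    {ω | j ∈ Macro.activeSet M ε (fun t => z t ω) n ∧
      Macro.numUpdates M ε (fun t => z t ω) j n = s ∧
      ∃ i, Macro.IsBestScore A ℓ M ε (fun t => z t ω) δ n j i ∧
        Macro.regret A ℓ M ε (fun t => z t ω) j n / s + 6 * ε + Macro.baseDev δ β s <
          Macro.condRisk P z ℓ n (Macro.hyp A M ε (fun t => z t ω) j i) ω -
            ⨅ h, Macro.condRisk P z ℓ n h ω} with hE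
  -- Freezing the random index and its random update count at deterministic values `j` and `s` makes
  -- the fixed-`s` bound applicable; indices outside the support form a null set.
  have hcover : B ⊆ ({ω | I ω ∉ Macro.supp P I} ∪
      ⋃ j ∈ hfin.toFinset, ⋃ s ∈ Finset.Ico m (n + 1), E j s) ∪
        (Macro.favorable P z M ε I n k m)ᶜ := by
    intro ω hω
    by_cases hfav : ω ∈ Macro.favorable P z M ε I n k m
    swap
    · exact Or.inr hfav
    left
    by_cases hI : I ω ∈ Macro.supp P I
    swap
    · exact Or.inl hI
    right
    have hms := hfav.2 _ hI
    have hsn : Macro.numUpdates M ε (fun t => z t ω) (I ω) n ≤ n := Nat.count_le _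
    simp only [Set.mem_iUnion]
    refine ⟨I ω, hfin.mem_toFinset.2 hI, Macro.numUpdates M ε (fun t => z t ω) (I ω) n,
      Finset.mem_Ico.2 ⟨hms, Nat.lt_succ_of_le hsn⟩, (hI_min ω).1, rfl, i ω, hi_min ω, ?_⟩
    have hdev := Macro.baseDev_le_devTerm hδ0 β (hm.trans hms)
      (Macro.one_le_seqCoveringNumber (ℓ := ℓ) β n)
    rw [← EReal.coe_lt_coe_iff, EReal.coe_add]
    exact (add_le_add le_rfl hdev).trans_lt hω
  have hj : ∀ j, P (⋃ s ∈ Finset.Ico m (n + 1), E j s) ≤ ENNReal.ofReal (δ / m) := by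
    intro j
    calc P (⋃ s ∈ Finset.Ico m (n + 1), E j s)
        ≤ ∑ s ∈ Finset.Ico m (n + 1), P (E j s) := measure_biUnion_finset_le _ _
      _ ≤ ∑ s ∈ Finset.Ico m (n + 1), ENNReal.ofReal (δ / ((s : ℝ) * (s + 1))) :=
          Finset.sum_le_sum fun s hs => Macro.measure_excess_le P hz hℓ hℓ01 hM hdM hε hA hδ0 hδ1
            hβ n j (hm.trans (Finset.mem_Ico.1 hs).1)
      _ = ENNReal.ofReal (∑ s ∈ Finset.Ico m (n + 1), δ / ((s : ℝ) * (s + 1))) :=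
          (ENNReal.ofReal_sum_of_nonneg fun s _ => by positivity).symm
      _ ≤ ENNReal.ofReal (δ / m) :=
          ENNReal.ofReal_le_ofReal (Macro.sum_one_div_mul_succ_le hδ0 hm _)
  have hmain : P (⋃ j ∈ hfin.toFinset, ⋃ s ∈ Finset.Ico m (n + 1), E j s) ≤
      ENNReal.ofReal (k * δ / m) := by
    calc P (⋃ j ∈ hfin.toFinset, ⋃ s ∈ Finset.Ico m (n + 1), E j s)
        ≤ ∑ j ∈ hfin.toFinset, P (⋃ s ∈ Finset.Ico m (n + 1), E j s) :=
          measure_biUnion_finset_le _ _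
      _ ≤ ∑ _j ∈ hfin.toFinset, ENNReal.ofReal (δ / m) := Finset.sum_le_sum fun j _ => hj j
      _ = ENNReal.ofReal (hfin.toFinset.card * (δ / m)) := by
          rw [Finset.sum_const, ← ENNReal.ofReal_nsmul, nsmul_eq_mul]
      _ ≤ ENNReal.ofReal (k * δ / m) := by
          rw [mul_div_assoc]
          refine ENNReal.ofReal_le_ofReal (mul_le_mul_of_nonneg_right ?_ (by positivity))
          exact_mod_cast hcard
  calc P B ≤ P ({ω | I ω ∉ Macro.supp P I} ∪
          ⋃ j ∈ hfin.toFinset, ⋃ s ∈ Finset.Ico m (n + 1), E j s) +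
        P (Macro.favorable P z M ε I n k m)ᶜ :=
        (measure_mono hcover).trans (measure_union_le _ _)
    _ ≤ (0 + ENNReal.ofReal (k * δ / m)) + P (Macro.favorable P z M ε I n k m)ᶜ := by
        refine add_le_add ((measure_union_le _ _).trans (add_le_add ?_ hmain)) le_rfl
        exact (Macro.measure_compl_supp_eq_zero P I).le
    _ = _ := by rw [zero_add]
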